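/- **Signature.** Terms are built from variables, names and the following function symbols, together with tuples $(T_1,\dots,T_n)$ for all $n$. *Public:* constants $\mathsf{p_s},\mathsf{p_d},\mathsf{true},\mathsf{false},\bot,\mathsf{os}$ and the message tags $\mathsf{reset\_req},\mathsf{reset\_resp},\mathsf{extend\_req},\mathsf{extend\_resp},\mathsf{ext\_channel},\mathsf{tag\_unseal},\mathsf{tag\_plain},\mathsf{drt\_req},\mathsf{drt\_resp}$; functions $\mathsf h/1$, $\mathsf{senc}/2$, $\mathsf{sdec}/2$, $\mathsf{seal}/2$, $\mathsf{prog}/1$, the readers $\mathsf{pcr},\mathsf{int},\mathsf{cache},\mathsf{stm},\mathsf{smi},\mathsf{init},\mathsf{pp},\mathsf{lock}$ (all unary), and the writers $\mathsf{reset},\mathsf{extend},\mathsf{set\_pcr},\mathsf{set\_int},\mathsf{set\_init},\mathsf{set\_pp},\mathsf{set\_lock}$ (ternary), $\mathsf{cache}$ (binary), $\mathsf{flush\_stm},\mathsf{flush\_smi}$ (unary). *Private:* $\mathsf{unseal}/2$, $\mathsf{get\_entry}/1$, $\mathsf{state}/4,\mathsf{tpm}/1,\mathsf{cpu}/2,\mathsf{smram}/2,\mathsf{drt}/3$,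 $\mathsf{tpm\_ch}/1$, the constants $\mathsf{tpm\_acc},\mathsf{cpu\_acc},\mathsf{cpu\_tpm}$, and infinitely many constants (program entry points), three of which are $\mathsf{Tinit},\mathsf{Tpp},\mathsf{Tstm}$. **Theory.** $\mathcal E_{\rm drt}=\mathcal E_{\rm data}\cup\mathcal E_{\rm prog}\cup\mathcal E_{\rm state}$ is given by the rewrite rules below; $U=_{\mathcal E}V$ means that $U,V$ have the same normal form, and a destructor is a symbol heading a left-hand side. $\mathcal E_{\rm data}$: $\mathsf{sdec}(\mathsf{senc}(v,k),k)\to v$, $\ \mathsf{unseal}(\mathsf{seal}(v,p),p)\to v$. $\ \mathcal E_{\rm prog}$: $\mathsf{get\_entry}(\mathsf{prog}(x))\to x$. $\mathcal E_{\rm state}$: platform states have the form $S=\mathsf{state}(\mathsf{tpm}(T_{PCR}),\mathsf{cpu}(T_{INT},T_{CACHE}),\mathsf{smram}(T_{STM},T_{SMI}),\mathsf{drt}(T_{INIT},T_{PP},T_{LOCK}))$. Each reader, applied to a state, rewrites to the corresponding component (only the one of the four blocks that contains this component needs to have the displayed form). Each writer rewrites to the state $S$ with one component changed (again only the blocks mentioned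 need to have the displayed form): $\mathsf{reset}(S,\mathsf{tpm\_acc},p)$ with $p\in\{\mathsf{p_s},\mathsf{p_d}\}$ sets $T_{PCR}:=p$; $\mathsf{extend}(S,\mathsf{tpm\_acc},v)$ sets $T_{PCR}:=\mathsf h((T_{PCR},v))$; $\mathsf{set\_pcr}(S,\mathsf{tpm\_acc},v)$ sets $T_{PCR}:=v$; $\mathsf{set\_int}(S,a,v)$ sets $T_{INT}:=v$ if $a=\mathsf{cpu\_acc}$, or if $T_{PP}=\mathsf{prog}(a)$ and $T_{LOCK}=\mathsf{true}$; $\mathsf{cache}(S,v)$ sets $T_{CACHE}:=v$; $\mathsf{flush\_stm}(S)$ sets $T_{STM}:=T_{CACHE}$ if $T_{LOCK}=\mathsf{false}$; $\mathsf{flush\_smi}(S)$ sets $T_{SMI}:=T_{CACHE}$; $\mathsf{set\_init}(S,\mathsf{cpu\_acc},v)$ sets $T_{INIT}:=v$; $\mathsf{set\_pp}(S,a,v)$ sets $T_{PP}:=v$ if $a=\mathsf{cpu\_acc}$, or $T_{INIT}=\mathsf{prog}(a)$, or $a=(z_1,z_2)$, $T_{INT}=\mathsf{true}$, $T_{STM}=\mathsf{prog}(z_1)$,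 $T_{SMI}=\mathsf{prog}(z_2)$; $\mathsf{set\_lock}(S,a,v)$ sets $T_{LOCK}:=v$ if $a=\mathsf{cpu\_acc}$, or $T_{PP}=\mathsf{prog}(a)$, or $a=(z_1,z_2)$, $T_{INT}=\mathsf{true}$, $T_{STM}=\mathsf{prog}(z_1)$, $T_{SMI}=\mathsf{prog}(z_2)$. **Deduction.** $S\vdash T$ is the least relation such that $S\vdash T$ if $T=_{\mathcal E}T'$ for some $T'\in S$; or $T=_{\mathcal E}f(T_1,\dots,T_n)$ with $f$ public (or a tuple) and all $S\vdash T_i$; or $T=_{\mathcal E}T_i$ for a component $T_i$ of a tuple with $S\vdash(T_1,\dots,T_n)$. **Processes** are $0$, $P\mid Q$, $!P$, $\mathsf{new}\,n;P$, $\mathsf{in}(U,A);P$, $\mathsf{out}(U,T);P$, $\mathsf{if}\ U=V\ \mathsf{then}\ P\ \mathsf{else}\ Q$ (a missing else-branch is $0$), $\mathsf{let}\ x=T\ \mathsf{in}\ P$. As in ProVerif, an input pattern $A$ is built by tupling from variables to be bound and equality tests $=\!T$. Configurations $(\mathcal N,\mathcal M,\mathcal P)$ consist of the names in use, the terms revealed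 to the attacker, and a multiset of processes. The steps are: $0$ disappears; $!P$ becomes $P,\,!P$; $P\mid Q$ becomes $P,Q$; $\mathsf{new}\,n;P$ becomes $P[n\mapsto n']$ with $n'\notin\mathcal N$, and $n'$ is added to $\mathcal N$; $\mathsf{out}(U,T);P$ and $\mathsf{in}(U',A);Q$ with $U=_{\mathcal E}U'$ and $T=_{\mathcal E}A\sigma$ become $P$, $Q\sigma$ ($\sigma$ normalized), and $T$ is added to $\mathcal M$ if $\mathcal M\vdash U$; a conditional becomes its first branch if $U=_{\mathcal E}V$ and its second branch otherwise; $\mathsf{let}\ x=T\ \mathsf{in}\ P$ becomes $P[x\mapsto T{\downarrow}]$ provided that the normal form $T{\downarrow}$ contains no destructor. $P\models\mathrm{Att}(T)$ means: there is a process $Q$ without private symbols and an execution $(\mathcal N_{\rm init},\emptyset,\{P\mid Q\})\to^*(\mathcal N',\mathcal M',\mathcal P')$ with $\mathcal M'\vdash T$, where $\mathcal N_{\rm init}$ is the set of free names of $P\mid Q$. For the name $k$ bound by a restriction in $P$, $\mathrm{Att}(k)$ refers to the fresh name created in this execution when that restriction of $P$ is executed. **The process** $\mathrm{DRT}=\mathrm{TPM}\mid\mathrm{EXEC}$.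 Below, a tag or a previously bound identifier inside an input pattern is an equality test; every other identifier is bound by the pattern. $\mathrm{TPM}={!\mathrm{TPM}_{R}}\mid{!\mathrm{TPM}_{E}}\mid{!\mathrm{TPM}_{U}}$, where $\mathrm{TPM}_R=(\mathsf{let}\ (ch,rv)=(\mathsf{cpu\_tpm},\mathsf{p_d})\ \mathsf{in}\ !R)\mid(\mathsf{let}\ (ch,rv)=(\mathsf{os},\mathsf{p_s})\ \mathsf{in}\ !R)$, $R=\mathsf{in}(ch,(\mathsf{reset\_req},n,s));\mathsf{let}\ s'=\mathsf{reset}(s,\mathsf{tpm\_acc},rv)\ \mathsf{in}\ \mathsf{out}(ch,(\mathsf{reset\_resp},n,s'))$; $\mathrm{TPM}_E=(\mathsf{let}\ ch=\mathsf{cpu\_tpm}\ \mathsf{in}\ !X)\mid(\mathsf{let}\ ch=\mathsf{os}\ \mathsf{in}\ !X)\mid{!(\mathsf{in}(\mathsf{cpu\_tpm},(\mathsf{ext\_channel},ch));!X)}$, $X=\mathsf{in}(ch,(\mathsf{extend\_req},n,s,v));\mathsf{let}\ s'=\mathsf{extend}(s,\mathsf{tpm\_acc},v)\ \mathsf{in}\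 \mathsf{out}(ch,(\mathsf{extend\_resp},n,s'))$; $\mathrm{TPM}_U=\mathsf{in}(\mathsf{os},s);\mathsf{if}\ \mathsf{lock}(s)=\mathsf{true}\ \mathsf{then}\ \mathsf{let}\ ch=\mathsf{tpm\_ch}(\mathsf{pp}(s))\ \mathsf{in}\ Y\ \mathsf{else}\ \mathsf{let}\ ch=\mathsf{os}\ \mathsf{in}\ Y$, $Y=\mathsf{in}(ch,(\mathsf{tag\_unseal},b));\mathsf{let}\ v=\mathsf{unseal}(b,\mathsf{pcr}(s))\ \mathsf{in}\ \mathsf{out}(ch,(\mathsf{tag\_plain},v))$. $\mathrm{EXEC}=\mathrm{CPU}\mid{!\mathrm{INIT}}\mid\mathrm{SETUP}\mid\mathrm{DATA}\mid{!\mathrm{PP}}$, where $\mathrm{CPU}={!\,}\mathsf{in}(\mathsf{os},(\mathsf{drt\_req},i,p,s));\ \mathsf{if}\ \mathsf{lock}(s)=\mathsf{false}\ \mathsf{then}\ \mathsf{let}\ s_0'=\mathsf{set\_int}(s,\mathsf{cpu\_acc},\mathsf{false})\ \mathsf{in}\ \mathsf{let}\ s_0=\mathsf{set\_lock}(s_0',\mathsf{cpu\_acc},\mathsf{true})\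 \mathsf{in}\ \mathsf{let}\ m=(\mathsf h(i),\mathsf h(\mathsf{stm}(s)))\ \mathsf{in}\ \mathsf{new}\,n;\ \mathsf{out}(\mathsf{cpu\_tpm},(\mathsf{reset\_req},n,s_0));\ \mathsf{in}(\mathsf{cpu\_tpm},(\mathsf{reset\_resp},n,s_1));\ \mathsf{out}(\mathsf{cpu\_tpm},(\mathsf{extend\_req},n,s_1,m));\ \mathsf{in}(\mathsf{cpu\_tpm},(\mathsf{extend\_resp},n,s_2));\ \mathsf{let}\ s_3=\mathsf{set\_init}(s_2,\mathsf{cpu\_acc},i)\ \mathsf{in}\ \mathsf{let}\ e=\mathsf{get\_entry}(i)\ \mathsf{in}\ \mathsf{out}(e,(n,s_3,\mathsf{tpm\_ch}(i),p));\ \mathsf{out}(\mathsf{cpu\_tpm},(\mathsf{ext\_channel},\mathsf{tpm\_ch}(i)));\ \mathsf{in}(e,(\mathsf{drt\_resp},n,s_4));\ \mathsf{let}\ e'=\mathsf{get\_entry}(\mathsf{pp}(s_4))\ \mathsf{in}\ \mathsf{out}(e',(s_4,\mathsf{tpm\_ch}(\mathsf{prog}(e'))));\ \mathsf{out}(\mathsf{cpu\_tpm},(\mathsf{ext\_channel},\mathsf{tpm\_ch}(\mathsf{prog}(e'))))$;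 $\mathrm{INIT}=\mathsf{out}(\mathsf{os},\mathsf{prog}(\mathsf{Tinit}));\ \mathsf{out}(\mathsf{os},\mathsf{prog}(\mathsf{Tstm}));\ \mathsf{in}(\mathsf{Tinit},(n,s,c,p));\ \mathsf{let}\ m=\mathsf h(p)\ \mathsf{in}\ \mathsf{new}\,n_1;\ \mathsf{out}(c,(\mathsf{extend\_req},n_1,s,m));\ \mathsf{in}(c,(\mathsf{extend\_resp},n_1,s'));\ \mathsf{let}\ s''=\mathsf{set\_pp}(s',\mathsf{Tinit},p)\ \mathsf{in}\ \mathsf{out}(\mathsf{Tinit},(\mathsf{drt\_resp},n,s''));\ \mathsf{out}(\mathsf{os},s'')$; $\mathrm{PP}=\mathsf{out}(\mathsf{os},\mathsf{prog}(\mathsf{Tpp}));\ \mathsf{in}(\mathsf{Tpp},(s_0,c));\ \mathsf{let}\ s=\mathsf{set\_int}(s_0,\mathsf{Tpp},\mathsf{true})\ \mathsf{in}\ \mathsf{out}(\mathsf{os},s);\ \mathsf{in}(\mathsf{os},x_1);\ \mathsf{in}(\mathsf{os},x_2);\ \mathsf{out}(c,(\mathsf{tag\_unseal},x_1));\ \mathsf{in}(c,(\mathsf{tag\_plain},x_k));\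 \mathsf{let}\ m=\mathsf{sdec}(x_2,x_k)\ \mathsf{in}\ \mathsf{out}(\mathsf{os},m);\ \mathsf{new}\,r;\ \mathsf{out}(c,(\mathsf{extend\_req},r,s,\bot));\ \mathsf{in}(c,(\mathsf{extend\_resp},r,s'));\ \mathsf{let}\ s''=\mathsf{set\_lock}(s',\mathsf{Tpp},\mathsf{false})\ \mathsf{in}\ \mathsf{out}(\mathsf{os},s'')$; $\mathrm{SETUP}=\mathsf{in}(\mathsf{os},x_{stm});\ \mathsf{in}(\mathsf{os},x_{smi});\ \mathsf{out}(\mathsf{os},\mathsf{state}(\mathsf{tpm}(\mathsf{p_s}),\mathsf{cpu}(\mathsf{true},\bot),\mathsf{smram}(x_{stm},x_{smi}),\mathsf{drt}(\bot,\bot,\mathsf{false})));\ \mathsf{in}(\mathsf{os},i);\ \mathsf{in}(\mathsf{os},p);\ \mathsf{in}(\mathsf{os},s);\ \mathsf{out}(\mathsf{os},(\mathsf{drt\_req},i,p,s))$; $\mathrm{DATA}=\mathsf{new}\,k_{pp};\ \mathsf{new}\,hi_{pp};\ \mathsf{out}(\mathsf{os},\mathsf{senc}(hi_{pp},k_{pp}));\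 \mathsf{let}\ x=\mathsf{seal}(k_{pp},\mathsf{hchain})\ \mathsf{in}\ \mathsf{out}(\mathsf{os},x)$, with $\mathsf{hchain}=\mathsf h((\mathsf h((\mathsf{p_d},(\mathsf h(\mathsf{prog}(\mathsf{Tinit})),\mathsf h(\mathsf{prog}(\mathsf{Tstm}))))),\mathsf h(\mathsf{prog}(\mathsf{Tpp}))))$. **Theorem.** Modulo $\mathcal E_{\rm drt}$, the process $\mathrm{DRT}$ satisfies: 1. (Code integrity $\Phi_{int}$) For all terms $x,y,x_{stm},x_{smi},x_{init},x_{pp}$: if $\mathrm{DRT}\models\mathrm{Att}\big(\mathsf{state}(\mathsf{tpm}(\mathsf{hchain}),\mathsf{cpu}(x,y),\mathsf{smram}(x_{stm},x_{smi}),\mathsf{drt}(x_{init},x_{pp},\mathsf{true}))\big)$, then $(x_{init},x_{pp},x_{stm})=_{\mathcal E_{\rm drt}}(\mathsf{prog}(\mathsf{Tinit}),\mathsf{prog}(\mathsf{Tpp}),\mathsf{prog}(\mathsf{Tstm}))$. 2. (Data secrecy $\Phi_{sec}$) $\mathrm{DRT}\models\mathrm{Att}(k_{pp})$ does not hold. 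-/

import Mathlib

namespace DRT

/-! ## Terms and signature -/

/-- Variables: those written in the processes below, and infinitely many others. -/
inductive Var
  | ch | rv | nonce | nonce1 | rand | pfState | pfState0 | pfSt | newSt | newState | val | blob
  | init | pp | s0' | s0 | s1 | s2 | s3 | measure | einit | epp | tpmc | extSt
  | xSeal | xEnc | xK | mess | exts | ends | kpp | hipp | sealedKey
  | xInt | xCache | xStm | xSmi | xInit | xPp
  | other (n : ℕ)
  deriving DecidableEq

/-- Function symbols. -/
inductive Sym
  -- tuples `(T₁, …, Tₙ)`
  | tup (n : ℕ)
  -- cryptographic primitives and platform constants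
  | ps | pd | true | false | bot | h | senc | sdec | sealData | unsealData
  -- programs: `entry i` are the (infinitely many) private entry points
  | prog | entry (i : ℕ) | get_entry
  -- platform states
  | state | tpm | cpu | smram | drt
  -- read access
  | pcr | int | cache | stm | smi | init | pp | lock
  -- write access
  | tpm_acc | cpu_acc | reset | extend | set_pcr | set_int | set_cache | flush_stm | flush_smi
  | set_init | set_pp | set_lock
  -- channels
  | os | cpu_tpm | tpm_ch
  -- message tags
  | reset_req | reset_resp | extend_req | extend_resp | ext_channel
  | tag_unsealing | tag_plain | drt_req | drt_resp

def Sym.arity : Sym → ℕ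
  | .tup n => n
  | .h | .prog | .get_entry | .tpm | .tpm_ch => 1
  | .pcr | .int | .cache | .stm | .smi | .init | .pp | .lock => 1
  | .flush_stm | .flush_smi => 1
  | .senc | .sdec | .sealData | .unsealData | .cpu | .smram | .set_cache => 2
  | .drt | .reset | .extend | .set_pcr | .set_int | .set_init | .set_pp | .set_lock => 3
  | .state => 4
  | _ => 0

/-- The private symbols; every other symbol is public. -/
def Sym.IsPrivate : Sym → Prop
  | .unsealData | .entry _ | .get_entry => True
  | .state | .tpm | .cpu | .smram | .drt => True
  | .tpm_acc | .cpu_acc | .cpu_tpm | .tpm_ch => True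
  | _ => False

/-- Terms over variables, names (indexed by `ℕ`) and function symbols. -/
inductive Term
  | var (x : Var)
  | name (n : ℕ)
  | app (f : Sym) (ts : Fin f.arity → Term)

abbrev Subst := Var → Term

def Term.subst (σ : Subst) : Term → Term
  | .var x => σ x
  | .name n => .name n
  | .app f ts => .app f (fun i => (ts i).subst σ)

/-- The names that occur in a term. -/
def Term.names : Term → Set ℕ
  | .var _ => ∅
  | .name n => {n}
  | .app _ ts => ⋃ i, (ts i).names

/-- No private symbol occurs in the term. -/
def Term.IsPublic : Term → Prop
  | .var _ => True
  | .name _ => True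
  | .app f ts => ¬ f.IsPrivate ∧ ∀ i, (ts i).IsPublic

/-! ## Rewriting, equality modulo a theory, deduction

A theory `E` is given by the set of all instances `Uσ → Vσ` of its rewrite rules. -/

abbrev Theory := Term → Term → Prop

/-- One rewrite step, at any position. -/
inductive Rew (E : Theory) : Term → Term → Prop
  | root {U V : Term} : E U V → Rew E U V
  | arg (f : Sym) (ts : Fin f.arity → Term) (i : Fin f.arity) {U : Term} :
      Rew E (ts i) U → Rew E (.app f ts) (.app f (Function.update ts i U))

def Irred (E : Theory) (T : Term) : Prop := ∀ U, ¬ Rew E T U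

/-- `U` is a normal form `T↓` of `T`. -/
def IsNormalForm (E : Theory) (T U : Term) : Prop :=
  Relation.ReflTransGen (Rew E) T U ∧ Irred E U

/-- `U =_E V`: the normal forms of `U` and `V` coincide. -/
def EqE (E : Theory) (U V : Term) : Prop :=
  ∃ W, IsNormalForm E U W ∧ IsNormalForm E V W

/-- A destructor is a symbol at the head of a rewrite rule. -/
def IsDestructor (E : Theory) (f : Sym) : Prop := ∃ ts V, E (.app f ts) V

def NoDestructor (E : Theory) : Term → Prop
  | .var _ => True
  | .name _ => True
  | .app f ts => ¬ IsDestructor E f ∧ ∀ i, NoDestructor E (ts i)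

/-- The deduction relation `S ⊢_E T`. -/
inductive Deduces (E : Theory) (S : Set Term) : Term → Prop
  | ax {T' T : Term} : T' ∈ S → EqE E T' T → Deduces E S T
  | app {f : Sym} {ts : Fin f.arity → Term} {T : Term} : ¬ f.IsPrivate →
      (∀ i, Deduces E S (ts i)) → EqE E (.app f ts) T → Deduces E S T
  | proj {n : ℕ} {ts : Fin (Sym.tup n).arity → Term} (i : Fin (Sym.tup n).arity) {T : Term} :
      Deduces E S (.app (.tup n) ts) → EqE E (ts i) T → Deduces E S T

/-! ## The process calculus -/

/-- Input patterns, as in ProVerif: a variable to be bound, an equality test against a term,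
or a tuple of patterns. -/
inductive Pat
  | bind (x : Var)
  | test (T : Term)
  | tup {n : ℕ} (As : Fin n → Pat)

/-- The pattern read as a term. -/
def Pat.toTerm : Pat → Term
  | .bind x => .var x
  | .test T => T
  | .tup (n := n) As => .app (.tup n) (fun i => (As i).toTerm)

/-- The variables bound by a pattern. -/
def Pat.binds : Pat → Set Var
  | .bind x => {x}
  | .test _ => ∅
  | .tup As => ⋃ i, (As i).binds

/-- Processes. A restricted name is represented, in the body of the restriction, by the variable
that `new` binds; the names that occur in a process are its free names. -/
inductive Proc
  | nil
  | par (P Q : Proc)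
  | repl (P : Proc)
  | new (x : Var) (P : Proc)
  | inp (U : Term) (A : Pat) (P : Proc)
  | out (U T : Term) (P : Proc)
  | ite (U V : Term) (P Q : Proc)
  | letIn (x : Var) (T : Term) (P : Proc)

def Proc.names : Proc → Set ℕ
  | .nil => ∅
  | .par P Q => P.names ∪ Q.names
  | .repl P => P.names
  | .new _ P => P.names
  | .inp U A P => U.names ∪ A.toTerm.names ∪ P.names
  | .out U T P => U.names ∪ T.names ∪ P.names
  | .ite U V P Q => U.names ∪ V.names ∪ P.names ∪ Q.names
  | .letIn _ T P => T.names ∪ P.names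

/-- No private symbol occurs in the process. -/
def Proc.IsPublic : Proc → Prop
  | .nil => True
  | .par P Q => P.IsPublic ∧ Q.IsPublic
  | .repl P => P.IsPublic
  | .new _ P => P.IsPublic
  | .inp U A P => U.IsPublic ∧ A.toTerm.IsPublic ∧ P.IsPublic
  | .out U T P => U.IsPublic ∧ T.IsPublic ∧ P.IsPublic
  | .ite U V P Q => U.IsPublic ∧ V.IsPublic ∧ P.IsPublic ∧ Q.IsPublic
  | .letIn _ T P => T.IsPublic ∧ P.IsPublic

/-- Configurations `(N, M, 𝒫)`. A running process `Pσ` is kept as the pair `(σ, P)`. -/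
structure Config where
  N : Set ℕ
  M : Set Term
  procs : Multiset (Subst × Proc)

/-- `σ'` extends `σ` by (normalized) values for the variables bound by the pattern `A`, in such
a way that the message `T` is an instance of `A` modulo `E`. -/
def Matches (E : Theory) (σ : Subst) (A : Pat) (T : Term) (σ' : Subst) : Prop :=
  (∀ x, x ∉ A.binds → σ' x = σ x) ∧ (∀ x ∈ A.binds, Irred E (σ' x)) ∧
    EqE E T (A.toTerm.subst σ')

/-- Operational semantics. -/
inductive Step (E : Theory) : Config → Config → Prop
  | nil (N M Ps σ) : Step E ⟨N, M, (σ, .nil) ::ₘ Ps⟩ ⟨N, M, Ps⟩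
  | bang (N M Ps σ P) :
      Step E ⟨N, M, (σ, .repl P) ::ₘ Ps⟩ ⟨N, M, (σ, P) ::ₘ (σ, .repl P) ::ₘ Ps⟩
  | par (N M Ps σ P Q) :
      Step E ⟨N, M, (σ, .par P Q) ::ₘ Ps⟩ ⟨N, M, (σ, P) ::ₘ (σ, Q) ::ₘ Ps⟩
  | new (N M Ps σ x P) (n' : ℕ) : n' ∉ N →
      Step E ⟨N, M, (σ, .new x P) ::ₘ Ps⟩
        ⟨N ∪ {n'}, M, (Function.update σ x (.name n'), P) ::ₘ Ps⟩
  | comm (N M Ps) (σ U T P) (τ U' A Q) (τ' : Subst) :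
      EqE E (U.subst σ) (U'.subst τ) → Matches E τ A (T.subst σ) τ' →
      Step E ⟨N, M, (σ, .out U T P) ::ₘ (τ, .inp U' A Q) ::ₘ Ps⟩
        ⟨N, M ∪ {T' | Deduces E M (U.subst σ) ∧ T' = T.subst σ}, (σ, P) ::ₘ (τ', Q) ::ₘ Ps⟩
  | ifTrue (N M Ps σ U V P Q) : EqE E (U.subst σ) (V.subst σ) →
      Step E ⟨N, M, (σ, .ite U V P Q) ::ₘ Ps⟩ ⟨N, M, (σ, P) ::ₘ Ps⟩
  | ifFalse (N M Ps σ U V P Q) : ¬ EqE E (U.subst σ) (V.subst σ) →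
      Step E ⟨N, M, (σ, .ite U V P Q) ::ₘ Ps⟩ ⟨N, M, (σ, Q) ::ₘ Ps⟩
  | letIn (N M Ps σ x T P) (T' : Term) : IsNormalForm E (T.subst σ) T' → NoDestructor E T' →
      Step E ⟨N, M, (σ, .letIn x T P) ::ₘ Ps⟩ ⟨N, M, (Function.update σ x T', P) ::ₘ Ps⟩

/-- The execution relation `→*`. -/
abbrev Steps (E : Theory) : Config → Config → Prop := Relation.ReflTransGen (Step E)

/-- The configuration `(N_init, ∅, {P | Q})`, where `N_init` consists of the free names. -/
def initConfig (P Q : Proc) : Config :=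
  ⟨P.names ∪ Q.names, ∅, {(Term.var, .par P Q)}⟩

/-- `P ⊨_E Att(T)`: some attacker process, free of private symbols, learns `T` from `P`. -/
def Att (E : Theory) (P : Proc) (T : Term) : Prop :=
  ∃ Q : Proc, Q.IsPublic ∧ ∃ C : Config, Steps E (initConfig P Q) C ∧ Deduces E C.M T

/-- `P ⊨_E Att(T) ⟹ (U = V)`. -/
def AttImpliesEq (E : Theory) (P : Proc) (T U V : Term) : Prop :=
  ∀ σ : Subst, Att E P (T.subst σ) → EqE E (U.subst σ) (V.subst σ)

/-- `P ⊨_E Att(n)` for the name `n` restricted by the subprocess `new x; R` of `P`: in some run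
with an attacker, the attacker learns the fresh name `n` that is created when `new x; R` is
executed. (`R` should contain a private symbol, so that `new x; R` cannot stem from the
attacker.) -/
def AttNew (E : Theory) (P : Proc) (x : Var) (R : Proc) : Prop :=
  ∃ Q : Proc, Q.IsPublic ∧ ∃ (N : Set ℕ) (M : Set Term) (Ps : Multiset (Subst × Proc))
    (σ : Subst) (n : ℕ) (C : Config),
    Steps E (initConfig P Q) ⟨N, M, (σ, .new x R) ::ₘ Ps⟩ ∧ n ∉ N ∧
    Steps E ⟨N ∪ {n}, M, (Function.update σ x (.name n), R) ::ₘ Ps⟩ C ∧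
    Deduces E C.M (.name n)

/-- `P ⊨_E Att(n) ⟹ false`, for the name `n` restricted by the subprocess `new x; R` of `P`. -/
def AttNewImpliesFalse (E : Theory) (P : Proc) (x : Var) (R : Proc) : Prop :=
  AttNew E P x R → False

/-! ## Term constructors -/

abbrev V (x : Var) : Term := .var x
/-- A constant, i.e. a symbol of arity `0`. -/
abbrev K (f : Sym) (hf : f.arity = 0 := by rfl) : Term :=
  .app f (fun i => absurd i.isLt (by omega))
abbrev tup {n : ℕ} (ts : Fin n → Term) : Term := .app (.tup n) ts
abbrev h (a : Term) : Term := .app .h (![a] : Fin 1 → Term)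
abbrev senc (a b : Term) : Term := .app .senc (![a, b] : Fin 2 → Term)
abbrev sdec (a b : Term) : Term := .app .sdec (![a, b] : Fin 2 → Term)
abbrev sealData (a b : Term) : Term := .app .sealData (![a, b] : Fin 2 → Term)
abbrev unsealData (a b : Term) : Term := .app .unsealData (![a, b] : Fin 2 → Term)
abbrev prog (a : Term) : Term := .app .prog (![a] : Fin 1 → Term)
abbrev get_entry (a : Term) : Term := .app .get_entry (![a] : Fin 1 → Term)
abbrev state (a b c d : Term) : Term := .app .state (![a, b, c, d] : Fin 4 → Term)
abbrev tpm (a : Term) : Term := .app .tpm (![a] : Fin 1 → Term)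
abbrev cpu (a b : Term) : Term := .app .cpu (![a, b] : Fin 2 → Term)
abbrev smram (a b : Term) : Term := .app .smram (![a, b] : Fin 2 → Term)
abbrev drt (a b c : Term) : Term := .app .drt (![a, b, c] : Fin 3 → Term)
abbrev pcr (a : Term) : Term := .app .pcr (![a] : Fin 1 → Term)
abbrev int (a : Term) : Term := .app .int (![a] : Fin 1 → Term)
abbrev cache (a : Term) : Term := .app .cache (![a] : Fin 1 → Term)
abbrev stm (a : Term) : Term := .app .stm (![a] : Fin 1 → Term)
abbrev smi (a : Term) : Term := .app .smi (![a] : Fin 1 → Term)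
abbrev init (a : Term) : Term := .app .init (![a] : Fin 1 → Term)
abbrev pp (a : Term) : Term := .app .pp (![a] : Fin 1 → Term)
abbrev lock (a : Term) : Term := .app .lock (![a] : Fin 1 → Term)
abbrev reset (a b c : Term) : Term := .app .reset (![a, b, c] : Fin 3 → Term)
abbrev extend (a b c : Term) : Term := .app .extend (![a, b, c] : Fin 3 → Term)
abbrev set_pcr (a b c : Term) : Term := .app .set_pcr (![a, b, c] : Fin 3 → Term)
abbrev set_int (a b c : Term) : Term := .app .set_int (![a, b, c] : Fin 3 → Term)
/-- The binary symbol `cache`. -/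
abbrev set_cache (a b : Term) : Term := .app .set_cache (![a, b] : Fin 2 → Term)
abbrev flush_stm (a : Term) : Term := .app .flush_stm (![a] : Fin 1 → Term)
abbrev flush_smi (a : Term) : Term := .app .flush_smi (![a] : Fin 1 → Term)
abbrev set_init (a b c : Term) : Term := .app .set_init (![a, b, c] : Fin 3 → Term)
abbrev set_pp (a b c : Term) : Term := .app .set_pp (![a, b, c] : Fin 3 → Term)
abbrev set_lock (a b c : Term) : Term := .app .set_lock (![a, b, c] : Fin 3 → Term)
abbrev tpm_ch (a : Term) : Term := .app .tpm_ch (![a] : Fin 1 → Term)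

abbrev os : Term := K .os
abbrev cpu_tpm : Term := K .cpu_tpm
abbrev tpm_acc : Term := K .tpm_acc
abbrev cpu_acc : Term := K .cpu_acc
abbrev ps : Term := K .ps
abbrev pd : Term := K .pd
abbrev tt : Term := K .true
abbrev ff : Term := K .false
abbrev bot : Term := K .bot
/-- The private entry points of the trusted programs. -/
abbrev Tinit : Term := K (.entry 0)
abbrev Tpp : Term := K (.entry 1)
abbrev Tstm : Term := K (.entry 2)

/-! ## The equational theories -/

inductive Edata : Theory
  | sdec (v k) : Edata (sdec (senc v k) k) v
  | unsealData (v p) : Edata (unsealData (sealData v p) p) v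

inductive Eprog : Theory
  | get_entry (x) : Eprog (get_entry (prog x)) x

inductive Estate : Theory
  -- read access
  | pcr (y x₁ x₂ x₃) : Estate (pcr (state (tpm y) x₁ x₂ x₃)) y
  | int (x₁ y₁ y₂ x₂ x₃) : Estate (int (state x₁ (cpu y₁ y₂) x₂ x₃)) y₁
  | cache (x₁ y₁ y₂ x₂ x₃) : Estate (cache (state x₁ (cpu y₁ y₂) x₂ x₃)) y₂
  | stm (x₁ x₂ y₁ y₂ x₃) : Estate (stm (state x₁ x₂ (smram y₁ y₂) x₃)) y₁
  | smi (x₁ x₂ y₁ y₂ x₃) : Estate (smi (state x₁ x₂ (smram y₁ y₂) x₃)) y₂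
  | init (x₁ x₂ x₃ y₁ y₂ y₃) : Estate (init (state x₁ x₂ x₃ (drt y₁ y₂ y₃))) y₁
  | pp (x₁ x₂ x₃ y₁ y₂ y₃) : Estate (pp (state x₁ x₂ x₃ (drt y₁ y₂ y₃))) y₂
  | lock (x₁ x₂ x₃ y₁ y₂ y₃) : Estate (lock (state x₁ x₂ x₃ (drt y₁ y₂ y₃))) y₃
  -- write access
  | reset_ps (y x₁ x₂ x₃) :
      Estate (reset (state (tpm y) x₁ x₂ x₃) tpm_acc ps) (state (tpm ps) x₁ x₂ x₃)
  | reset_pd (y x₁ x₂ x₃) :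
      Estate (reset (state (tpm y) x₁ x₂ x₃) tpm_acc pd) (state (tpm pd) x₁ x₂ x₃)
  | extend (y x₁ x₂ x₃ v) :
      Estate (extend (state (tpm y) x₁ x₂ x₃) tpm_acc v) (state (tpm (h (tup ![y, v]))) x₁ x₂ x₃)
  | set_pcr (y x₁ x₂ x₃ v) :
      Estate (set_pcr (state (tpm y) x₁ x₂ x₃) tpm_acc v) (state (tpm v) x₁ x₂ x₃)
  | set_int_cpu (x₁ y₁ y₂ x₂ x₃ v) :
      Estate (set_int (state x₁ (cpu y₁ y₂) x₂ x₃) cpu_acc v) (state x₁ (cpu v y₂) x₂ x₃)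
  | set_int_pp (x₁ y z x₂ z₁ z₂ v) :
      Estate (set_int (state x₁ (cpu y z) x₂ (drt z₁ (prog z₂) tt)) z₂ v)
        (state x₁ (cpu v z) x₂ (drt z₁ (prog z₂) tt))
  | set_cache (x₁ y₁ y₂ x₂ x₃ v) :
      Estate (set_cache (state x₁ (cpu y₁ y₂) x₂ x₃) v) (state x₁ (cpu y₁ v) x₂ x₃)
  | flush_stm (x₁ y₁ v z₁ z₂ w₁ w₂) :
      Estate (flush_stm (state x₁ (cpu y₁ v) (smram z₁ z₂) (drt w₁ w₂ ff)))
        (state x₁ (cpu y₁ v) (smram v z₂) (drt w₁ w₂ ff))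
  | flush_smi (x₁ y₁ v z₁ z₂ x₂) :
      Estate (flush_smi (state x₁ (cpu y₁ v) (smram z₁ z₂) x₂))
        (state x₁ (cpu y₁ v) (smram z₁ v) x₂)
  | set_init (x₁ x₂ x₃ y₁ y₂ y₃ v) :
      Estate (set_init (state x₁ x₂ x₃ (drt y₁ y₂ y₃)) cpu_acc v)
        (state x₁ x₂ x₃ (drt v y₂ y₃))
  | set_pp_cpu (x₁ x₂ x₃ y₁ y₂ y₃ v) :
      Estate (set_pp (state x₁ x₂ x₃ (drt y₁ y₂ y₃)) cpu_acc v)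
        (state x₁ x₂ x₃ (drt y₁ v y₃))
  | set_pp_init (x₁ x₂ x₃ y₁ y₂ y₃ v) :
      Estate (set_pp (state x₁ x₂ x₃ (drt (prog y₁) y₂ y₃)) y₁ v)
        (state x₁ x₂ x₃ (drt (prog y₁) v y₃))
  | set_pp_smi (x z z₁ z₂ y₁ y₂ y₃ v) :
      Estate
        (set_pp (state x (cpu tt z) (smram (prog z₁) (prog z₂)) (drt y₁ y₂ y₃)) (tup ![z₁, z₂]) v)
        (state x (cpu tt z) (smram (prog z₁) (prog z₂)) (drt y₁ v y₃))
  | set_lock_cpu (x₁ x₂ x₃ y₁ y₂ y₃ v) :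
      Estate (set_lock (state x₁ x₂ x₃ (drt y₁ y₂ y₃)) cpu_acc v)
        (state x₁ x₂ x₃ (drt y₁ y₂ v))
  | set_lock_pp (x₁ x₂ x₃ y₁ y₂ y₃ v) :
      Estate (set_lock (state x₁ x₂ x₃ (drt y₁ (prog y₂) y₃)) y₂ v)
        (state x₁ x₂ x₃ (drt y₁ (prog y₂) v))
  | set_lock_smi (x z z₁ z₂ y₁ y₂ y₃ v) :
      Estate
        (set_lock (state x (cpu tt z) (smram (prog z₁) (prog z₂)) (drt y₁ y₂ y₃))
          (tup ![z₁, z₂]) v)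
        (state x (cpu tt z) (smram (prog z₁) (prog z₂)) (drt y₁ y₂ v))

/-- `E_drt = E_data ∪ E_prog ∪ E_state`. -/
def Edrt : Theory := fun U V => Edata U V ∨ Eprog U V ∨ Estate U V

/-! ## The TPM process -/

def PCR_RESET : Proc :=
  .inp (V .ch) (.tup ![.test (K .reset_req), .bind .nonce, .bind .pfState]) <|
  .letIn .newSt (reset (V .pfState) tpm_acc (V .rv)) <|
  .out (V .ch) (tup ![K .reset_resp, V .nonce, V .newSt]) .nil

def TPM_RESET : Proc :=
  .par (.letIn .ch cpu_tpm <| .letIn .rv pd <| .repl PCR_RESET)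
    (.letIn .ch os <| .letIn .rv ps <| .repl PCR_RESET)

def PCR_EXTEND : Proc :=
  .inp (V .ch)
    (.tup ![.test (K .extend_req), .bind .nonce, .bind .pfState, .bind .val]) <|
  .letIn .newSt (extend (V .pfState) tpm_acc (V .val)) <|
  .out (V .ch) (tup ![K .extend_resp, V .nonce, V .newSt]) .nil

def TPM_EXTEND : Proc :=
  .par (.letIn .ch cpu_tpm <| .repl PCR_EXTEND) <|
  .par (.letIn .ch os <| .repl PCR_EXTEND) <|
  .repl (.inp cpu_tpm (.tup ![.test (K .ext_channel), .bind .ch]) <| .repl PCR_EXTEND)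

def UNSEAL : Proc :=
  .inp (V .ch) (.tup ![.test (K .tag_unsealing), .bind .blob]) <|
  .letIn .val (unsealData (V .blob) (pcr (V .pfState))) <|
  .out (V .ch) (tup ![K .tag_plain, V .val]) .nil

def TPM_UNSEAL : Proc :=
  .inp os (.bind .pfState) <|
  .ite (lock (V .pfState)) tt
    (.letIn .ch (tpm_ch (pp (V .pfState))) UNSEAL)
    (.letIn .ch os UNSEAL)

def TPM : Proc := .par (.repl TPM_RESET) <| .par (.repl TPM_EXTEND) (.repl TPM_UNSEAL)

/-! ## Launch and execution of a dynamic root of trust -/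

def CPU : Proc :=
  .repl <|
  .inp os (.tup ![.test (K .drt_req), .bind .init, .bind .pp, .bind .pfState]) <|
  .ite (lock (V .pfState)) ff
    (.letIn .s0' (set_int (V .pfState) cpu_acc ff) <|
     .letIn .s0 (set_lock (V .s0') cpu_acc tt) <|
     .letIn .measure (tup ![h (V .init), h (stm (V .pfState))]) <|
     .new .nonce <|
     .out cpu_tpm (tup ![K .reset_req, V .nonce, V .s0]) <|
     .inp cpu_tpm (.tup ![.test (K .reset_resp), .test (V .nonce), .bind .s1]) <|
     .out cpu_tpm (tup ![K .extend_req, V .nonce, V .s1, V .measure]) <|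
     .inp cpu_tpm (.tup ![.test (K .extend_resp), .test (V .nonce), .bind .s2]) <|
     .letIn .s3 (set_init (V .s2) cpu_acc (V .init)) <|
     .letIn .einit (get_entry (V .init)) <|
     .out (V .einit) (tup ![V .nonce, V .s3, tpm_ch (V .init), V .pp]) <|
     .out cpu_tpm (tup ![K .ext_channel, tpm_ch (V .init)]) <|
     .inp (V .einit) (.tup ![.test (K .drt_resp), .test (V .nonce), .bind .newState]) <|
     .letIn .epp (get_entry (pp (V .newState))) <|
     .out (V .epp) (tup ![V .newState, tpm_ch (prog (V .epp))]) <|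
     .out cpu_tpm (tup ![K .ext_channel, tpm_ch (prog (V .epp))]) .nil)
    .nil

/-- The trusted `INIT` program. -/
def INIT : Proc :=
  .out os (prog Tinit) <|
  .out os (prog Tstm) <|
  .inp Tinit (.tup ![.bind .nonce, .bind .pfSt, .bind .tpmc, .bind .pp]) <|
  .letIn .measure (h (V .pp)) <|
  .new .nonce1 <|
  .out (V .tpmc) (tup ![K .extend_req, V .nonce1, V .pfSt, V .measure]) <|
  .inp (V .tpmc) (.tup ![.test (K .extend_resp), .test (V .nonce1), .bind .extSt]) <|
  .letIn .newSt (set_pp (V .extSt) Tinit (V .pp)) <|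
  .out Tinit (tup ![K .drt_resp, V .nonce, V .newSt]) <|
  .out os (V .newSt) .nil

/-- The trusted protected program `PP`. -/
def PP : Proc :=
  .out os (prog Tpp) <|
  .inp Tpp (.tup ![.bind .pfState0, .bind .tpmc]) <|
  .letIn .pfSt (set_int (V .pfState0) Tpp tt) <|
  .out os (V .pfSt) <|
  .inp os (.bind .xSeal) <|
  .inp os (.bind .xEnc) <|
  .out (V .tpmc) (tup ![K .tag_unsealing, V .xSeal]) <|
  .inp (V .tpmc) (.tup ![.test (K .tag_plain), .bind .xK]) <|
  .letIn .mess (sdec (V .xEnc) (V .xK)) <|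
  .out os (V .mess) <|
  .new .rand <|
  .out (V .tpmc) (tup ![K .extend_req, V .rand, V .pfSt, bot]) <|
  .inp (V .tpmc) (.tup ![.test (K .extend_resp), .test (V .rand), .bind .exts]) <|
  .letIn .ends (set_lock (V .exts) Tpp ff) <|
  .out os (V .ends) .nil

/-- The expected `PCR` value: `p_d` extended with the measurements of the trusted `INIT` and
`STM`, and then of the trusted `PP`. -/
def hchain : Term :=
  h (tup ![h (tup ![pd, tup ![h (prog Tinit), h (prog Tstm)]]), h (prog Tpp)])

/-- `DATA` after the restriction of `k_pp`. -/
def DATA_body : Proc :=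
  .new .hipp <|
  .out os (senc (V .hipp) (V .kpp)) <|
  .letIn .sealedKey (sealData (V .kpp) hchain) <|
  .out os (V .sealedKey) .nil

def DATA : Proc := .new .kpp DATA_body

def SETUP : Proc :=
  .inp os (.bind .xStm) <|
  .inp os (.bind .xSmi) <|
  .out os (state (tpm ps) (cpu tt bot) (smram (V .xStm) (V .xSmi)) (drt bot bot ff)) <|
  .inp os (.bind .init) <|
  .inp os (.bind .pp) <|
  .inp os (.bind .pfState) <|
  .out os (tup ![K .drt_req, V .init, V .pp, V .pfState]) .nil

def EXEC : Proc :=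
  .par CPU <| .par (.repl INIT) <| .par SETUP <| .par DATA (.repl PP)

/-- The full process `DRT = TPM | EXEC`. -/
def DRTproc : Proc := .par TPM EXEC

/-! ## The security properties -/

/-- Code integrity, `Φ_int`. -/
def CodeIntegrity (E : Theory) (P : Proc) : Prop :=
  AttImpliesEq E P
    (state (tpm hchain) (cpu (V .xInt) (V .xCache)) (smram (V .xStm) (V .xSmi))
      (drt (V .xInit) (V .xPp) tt))
    (tup ![V .xInit, V .xPp, V .xStm])
    (tup ![prog Tinit, prog Tpp, prog Tstm])

/-- Secrecy of the sealed key, `Φ_sec`: `Att(k_pp) ⟹ false`. -/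
def KeySecrecy (E : Theory) (P : Proc) : Prop :=
  AttNewImpliesFalse E P .kpp DATA_body

end DRT

/-!
The rewrite rules do not overlap, so that every term `T` has a normal form `T.nf`, computed by
contracting innermost subterms first, and `U =_E V` amounts to `U.nf = V.nf`.

The proof exhibits an invariant of executions. Every name in use is given a role (`Roles`): it is
known to the attacker, it is `k_pp`, or it is the nonce of one particular exchange between the TPM
and either the CPU or the trusted `INIT` program, which determines the platform state and the
measurement of that exchange. Relative to the roles, `Known` bounds the normal forms that the
attacker can deduce, and `PrivMsg` the messages on channels that the attacker does not know; every
process only sends such messages as long as it only receives such messages (`Safe`).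

A platform state that is known satisfies `Platform.Ok`. The only value of the `PCR` from which an
extension leads to `hchain` is that of a launch measuring `Tinit` and `Tstm`. It only occurs in
states that the CPU sends to the trusted `INIT` program, as `p_d` can only be written over the
private channel `cpu_tpm`. This program extends the `PCR` with the program that it stores as `PP`
before it reveals the state. From then on, `INIT`, `PP` and `STM` and the lock could only be
changed by the three trusted programs, and the one that does so, `PP`, first extends the `PCR`
once more. This is code integrity. As for secrecy, the TPM unseals `seal(k_pp, hchain)` only for a
state whose `PCR` is `hchain`, and then by code integrity it answers on the private channel
`tpm_ch(prog(Tpp))`.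
-/

namespace DRT

-- Lets `simp` treat the argument tuples `![a, b] : Fin f.arity → Term` as vectors of known length.
attribute [reducible] Sym.arity

/-! ### Evaluation and normal forms -/

theorem Edrt.unique {U W W' : Term} (hW : Edrt U W) (hW' : Edrt U W') : W = W' := by
  obtain ⟨U', hU⟩ : ∃ U', U' = U := ⟨U, rfl⟩
  rw [← hU] at hW'
  rcases hW with hW | hW | hW <;> rcases hW' with hW' | hW' | hW' <;> cases hW <;> cases hW' <;>
    simp_all <;> grind

open Classical in
/-- The result of contracting a term at its root; a term that is not an instance of the left-hand
side of a rule is left unchanged. -/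
noncomputable def Term.contract (U : Term) : Term :=
  if hU : ∃ W, Edrt U W then hU.choose else U

theorem Edrt.contract_eq {U W : Term} (hE : Edrt U W) : U.contract = W := by
  have hU : ∃ W, Edrt U W := ⟨W, hE⟩
  rw [Term.contract, dif_pos hU]
  exact hU.choose_spec.unique hE

theorem Term.edrt_contract_or_not_edrt (U : Term) :
    Edrt U U.contract ∨ (∀ W, ¬ Edrt U W) ∧ U.contract = U := by
  by_cases hU : ∃ W, Edrt U W
  · obtain ⟨W, hW⟩ := hU
    exact .inl (hW.contract_eq ▸ hW)
  · exact .inr ⟨not_exists.1 hU, dif_neg hU⟩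

/-- The value of a term under a valuation of its variables, computed innermost first. -/
noncomputable def Term.eval (v : Subst) : Term → Term
  | .var x => v x
  | .name n => .name n
  | .app f ts => (Term.app f fun i => (ts i).eval v).contract

/-- The normal form of a term. -/
noncomputable abbrev Term.nf (T : Term) : Term := T.eval Term.var

/-- Whether a symbol heads the left-hand side of a rule of `E_drt`; this decides
`IsDestructor Edrt`. -/
abbrev isRuleHead : Sym → Bool
  | .sdec | .unsealData | .get_entry => true
  | .pcr | .int | .cache | .stm | .smi | .init | .pp | .lock => true
  | .reset | .extend | .set_pcr | .set_int | .set_cache | .flush_stm | .flush_smi => true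
  | .set_init | .set_pp | .set_lock => true
  | _ => false

theorem Edrt.isRuleHead {f : Sym} {ts : Fin f.arity → Term} {W : Term}
    (hE : Edrt (.app f ts) W) : isRuleHead f = true := by
  generalize hU : Term.app f ts = U at hE
  rcases hE with hE | hE | hE <;> cases hE <;> cases hU <;> rfl

theorem isDestructor_of_isRuleHead {f : Sym} (hf : isRuleHead f = true) : IsDestructor Edrt f := by
  cases f <;> cases hf
  exacts [⟨_, _, .inl (.sdec bot bot)⟩, ⟨_, _, .inl (.unsealData bot bot)⟩,
    ⟨_, _, .inr (.inl (.get_entry bot))⟩, ⟨_, _, .inr (.inr (.pcr bot bot bot bot))⟩,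
    ⟨_, _, .inr (.inr (.int bot bot bot bot bot))⟩,
    ⟨_, _, .inr (.inr (.cache bot bot bot bot bot))⟩,
    ⟨_, _, .inr (.inr (.stm bot bot bot bot bot))⟩,
    ⟨_, _, .inr (.inr (.smi bot bot bot bot bot))⟩,
    ⟨_, _, .inr (.inr (.init bot bot bot bot bot bot))⟩,
    ⟨_, _, .inr (.inr (.pp bot bot bot bot bot bot))⟩,
    ⟨_, _, .inr (.inr (.lock bot bot bot bot bot bot))⟩,
    ⟨_, _, .inr (.inr (.reset_ps bot bot bot bot))⟩,
    ⟨_, _, .inr (.inr (.extend bot bot bot bot bot))⟩,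
    ⟨_, _, .inr (.inr (.set_pcr bot bot bot bot bot))⟩,
    ⟨_, _, .inr (.inr (.set_int_cpu bot bot bot bot bot bot))⟩,
    ⟨_, _, .inr (.inr (.set_cache bot bot bot bot bot bot))⟩,
    ⟨_, _, .inr (.inr (.flush_stm bot bot bot bot bot bot bot))⟩,
    ⟨_, _, .inr (.inr (.flush_smi bot bot bot bot bot bot))⟩,
    ⟨_, _, .inr (.inr (.set_init bot bot bot bot bot bot bot))⟩,
    ⟨_, _, .inr (.inr (.set_pp_cpu bot bot bot bot bot bot bot))⟩,
    ⟨_, _, .inr (.inr (.set_lock_cpu bot bot bot bot bot bot bot))⟩]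

theorem contract_constructor {f : Sym} (hf : isRuleHead f = false) (ts : Fin f.arity → Term) :
    (Term.app f ts).contract = .app f ts :=
  dif_neg fun ⟨_, hE⟩ => by simp [hE.isRuleHead] at hf

section Eval

variable (v : Subst)

@[simp]
theorem eval_var (x : Var) : (Term.var x).eval v = v x := rfl

@[simp]
theorem eval_constructor {f : Sym} (hf : isRuleHead f = false) (ts : Fin f.arity → Term) :
    (Term.app f ts).eval v = .app f (Term.eval v ∘ ts) :=
  contract_constructor hf _

@[simp]
theorem eval_destructor {f : Sym} (_ : isRuleHead f = true) (ts : Fin f.arity → Term) :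
    (Term.app f ts).eval v = (Term.app f (Term.eval v ∘ ts)).contract := rfl

@[simp high]
theorem eval_const (f : Sym) (hf : f.arity = 0) : (K f hf).eval v = K f hf := by
  have hhead : isRuleHead f = false := by cases f <;> simp_all [Sym.arity]
  rw [eval_constructor v hhead]
  congr 1
  funext i
  exact absurd i.isLt (by omega)

@[simp]
theorem comp_vecCons {α β : Type*} {n : ℕ} (g : α → β) (a : α) (w : Fin n → α) :
    g ∘ Matrix.vecCons a w = Matrix.vecCons (g a) (g ∘ w) := Fin.comp_cons g a w

@[simp]
theorem comp_vecEmpty {α β : Type*} (g : α → β) : g ∘ ![] = ![] := Subsingleton.elim _ _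

theorem eval_subst (σ : Subst) (T : Term) :
    (T.subst σ).eval v = T.eval fun x => (σ x).eval v := by
  induction T with
  | var x => rfl
  | name n => rfl
  | app f ts ih => exact congrArg (fun us => (Term.app f us).contract) (funext ih)

theorem Edrt.eval_eq {U W : Term} (hE : Edrt U W) : U.eval v = W.eval v := by
  rcases hE with hE | hE | hE <;> cases hE <;>
    simp only [↓eval_const, eval_destructor, eval_constructor, comp_vecCons, comp_vecEmpty] <;>
    refine Edrt.contract_eq ?_
  exacts [.inl (.sdec ..), .inl (.unsealData ..), .inr (.inl (.get_entry ..)),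
    .inr (.inr (.pcr ..)), .inr (.inr (.int ..)), .inr (.inr (.cache ..)), .inr (.inr (.stm ..)),
    .inr (.inr (.smi ..)), .inr (.inr (.init ..)), .inr (.inr (.pp ..)), .inr (.inr (.lock ..)),
    .inr (.inr (.reset_ps ..)), .inr (.inr (.reset_pd ..)), .inr (.inr (.extend ..)),
    .inr (.inr (.set_pcr ..)), .inr (.inr (.set_int_cpu ..)), .inr (.inr (.set_int_pp ..)),
    .inr (.inr (.set_cache ..)), .inr (.inr (.flush_stm ..)), .inr (.inr (.flush_smi ..)),
    .inr (.inr (.set_init ..)), .inr (.inr (.set_pp_cpu ..)), .inr (.inr (.set_pp_init ..)),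
    .inr (.inr (.set_pp_smi ..)), .inr (.inr (.set_lock_cpu ..)), .inr (.inr (.set_lock_pp ..)),
    .inr (.inr (.set_lock_smi ..))]

theorem Rew.eval_eq {U W : Term} (hR : Rew Edrt U W) : U.eval v = W.eval v := by
  induction hR with
  | root hE => exact hE.eval_eq v
  | arg f ts i _ ih =>
    refine congrArg (fun us => (Term.app f us).contract) (funext fun j => ?_)
    by_cases hj : j = i
    · subst hj
      simpa using ih
    · simp [hj]

end Eval

section Rewriting

variable {E : Theory}

theorem reflTransGen_rew_arg (f : Sym) (ts : Fin f.arity → Term) (i : Fin f.arity) {U : Term}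
    (hR : Relation.ReflTransGen (Rew E) (ts i) U) :
    Relation.ReflTransGen (Rew E) (.app f ts) (.app f (Function.update ts i U)) := by
  induction hR with
  | refl => simpa using Relation.ReflTransGen.refl
  | tail _ hR ih =>
    refine ih.tail ?_
    simpa using Rew.arg f (Function.update ts i _) i (by simpa using hR)

theorem reflTransGen_rew_args (f : Sym) (ts us : Fin f.arity → Term)
    (hR : ∀ i, Relation.ReflTransGen (Rew E) (ts i) (us i)) :
    Relation.ReflTransGen (Rew E) (.app f ts) (.app f us) := by
  suffices hs : ∀ s : Finset (Fin f.arity), Relation.ReflTransGen (Rew E) (.app f ts)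
      (.app f (s.piecewise us ts)) by simpa using hs Finset.univ
  intro s
  induction s using Finset.induction_on with
  | empty => simpa using Relation.ReflTransGen.refl
  | insert a s ha ih =>
    rw [Finset.piecewise_insert]
    exact ih.trans (reflTransGen_rew_arg f _ a (by simpa [ha] using hR a))

theorem irred_app_iff {f : Sym} {ts : Fin f.arity → Term} :
    Irred E (.app f ts) ↔ (∀ W, ¬ E (.app f ts) W) ∧ ∀ i, Irred E (ts i) := by
  refine ⟨fun hT => ⟨fun W hE => hT W (.root hE), fun i U hR => hT _ (.arg f ts i hR)⟩, ?_⟩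
  rintro ⟨hroot, hargs⟩ U hR
  generalize hT : Term.app f ts = T at hR
  cases hR with
  | root hE => exact hroot U (hT ▸ hE)
  | arg g us i hR =>
    cases hT
    exact hargs i _ hR

end Rewriting

theorem reflTransGen_rew_nf (T : Term) : Relation.ReflTransGen (Rew Edrt) T T.nf := by
  induction T with
  | var x => exact .refl
  | name n => exact .refl
  | app f ts ih =>
    refine (reflTransGen_rew_args f ts _ ih).trans ?_
    rcases Term.edrt_contract_or_not_edrt (.app f fun i => (ts i).nf) with hE | ⟨-, hE⟩
    · exact .single (.root hE)
    · exact hE.symm ▸ .refl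

theorem irred_constructor_iff {f : Sym} (hf : isRuleHead f = false) {ts : Fin f.arity → Term} :
    Irred Edrt (.app f ts) ↔ ∀ i, Irred Edrt (ts i) := by
  refine irred_app_iff.trans ⟨And.right, fun hts => ⟨fun W hE => ?_, hts⟩⟩
  simp [hE.isRuleHead] at hf

/-- The right-hand sides of the rules are built from their variables by constructors only. -/
theorem Edrt.irred {f : Sym} {ts : Fin f.arity → Term} {W : Term} (hE : Edrt (.app f ts) W)
    (hts : ∀ i, Irred Edrt (ts i)) : Irred Edrt W := by
  generalize hU : Term.app f ts = U at hE
  rcases hE with hE | hE | hE <;> cases hE <;> cases hU <;>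
    simp_all [Fin.forall_fin_succ, irred_constructor_iff]

theorem irred_nf (T : Term) : Irred Edrt T.nf := by
  induction T with
  | var x => rintro U ((hE | hE | hE) | _) <;> cases hE
  | name n => rintro U ((hE | hE | hE) | _) <;> cases hE
  | app f ts ih =>
    rcases Term.edrt_contract_or_not_edrt (.app f fun i => (ts i).nf) with hE | ⟨hnot, hE⟩
    · exact hE.irred ih
    · exact (congrArg _ hE).mpr (irred_app_iff.2 ⟨hnot, ih⟩)

theorem Irred.nf_eq {T : Term} (hT : Irred Edrt T) : T.nf = T := by
  rcases (reflTransGen_rew_nf T).cases_head with hnf | ⟨U, hU, -⟩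
  · exact hnf.symm
  · exact (hT U hU).elim

theorem reflTransGen_rew_nf_eq {T U : Term} (hR : Relation.ReflTransGen (Rew Edrt) T U) :
    T.nf = U.nf := by
  induction hR with
  | refl => rfl
  | tail _ hR ih => exact ih.trans (hR.eval_eq _)

theorem isNormalForm_iff {T U : Term} : IsNormalForm Edrt T U ↔ T.nf = U :=
  ⟨fun ⟨hTU, hU⟩ => (reflTransGen_rew_nf_eq hTU).trans hU.nf_eq,
    fun hU => hU ▸ ⟨reflTransGen_rew_nf T, irred_nf T⟩⟩

theorem eqE_iff {T U : Term} : EqE Edrt T U ↔ T.nf = U.nf := by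
  simp only [EqE, isNormalForm_iff, exists_eq_left', eq_comm (a := U.nf)]

theorem edrt_contract {f : Sym} {ts : Fin f.arity → Term}
    (hN : NoDestructor Edrt (Term.app f ts).contract) (hf : isRuleHead f = true := by rfl) :
    Edrt (.app f ts) (Term.app f ts).contract := by
  refine (Term.edrt_contract_or_not_edrt _).resolve_right ?_
  rintro ⟨-, hE⟩
  rw [hE] at hN
  exact hN.1 (isDestructor_of_isRuleHead hf)

theorem edrt_of_contract_eq {U W : Term} (hU : U.contract = W) (hne : U ≠ W) : Edrt U W :=
  hU ▸ (Term.edrt_contract_or_not_edrt U).resolve_right fun hirr => hne (hirr.2.symm.trans hU)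

@[simp]
theorem eval_hchain (v : Subst) : hchain.eval v = hchain := by simp [hchain]

/-! ### Roles of names and knowledge of the attacker -/

/-- A platform state, given by the values of its components. -/
structure Platform where
  (pcr int cache stm smi init pp lock : Term)

namespace Platform

/-- The term that represents a platform state. -/
@[simp]
def term (s : Platform) : Term :=
  state (tpm s.pcr) (cpu s.int s.cache) (smram s.stm s.smi) (drt s.init s.pp s.lock)

/-- The values of the components of a platform state. -/
@[simp]
def components (s : Platform) : List Term :=
  [s.pcr, s.int, s.cache, s.stm, s.smi, s.init, s.pp, s.lock]

end Platform

/-- The purpose of a name in an execution: `free` names are not yet in use, `key` is for `k_pp`, and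
the nonces with which the CPU (`launch`) and the trusted `INIT` program (`init`) tag their requests
to the TPM carry the platform state and the measurement of the first request. -/
inductive Role
  | free | pub | key
  | launch (s : Platform) (m : Term)
  | init (s : Platform) (m : Term)

/-- An assignment of roles to all names. -/
abbrev Roles := ℕ → Role

/-- `ρ'` arises from `ρ` by giving roles to further free names. -/
def Roles.Ext (ρ ρ' : Roles) : Prop := ∀ n, ρ n ≠ .free → ρ' n = ρ n

namespace Roles

variable {ρ ρ₁ ρ₂ ρ₃ : Roles} {n : ℕ} {r : Role}

theorem Ext.refl (ρ : Roles) : ρ.Ext ρ := fun _ _ => rfl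

theorem Ext.trans (h₁₂ : ρ₁.Ext ρ₂) (h₂₃ : ρ₂.Ext ρ₃) : ρ₁.Ext ρ₃ :=
  fun n hn => (h₂₃ n (h₁₂ n hn ▸ hn)).trans (h₁₂ n hn)

theorem Ext.apply_eq (hρ : ρ₁.Ext ρ₂) (hn : ρ₁ n = r) (hr : r ≠ .free) : ρ₂ n = r :=
  (hρ n (hn ▸ hr)).trans hn

theorem ext_update (hn : ρ n = .free) (r : Role) : ρ.Ext (Function.update ρ n r) :=
  fun _ hk => Function.update_of_ne (by grind) _ _

end Roles

/-- The `PCR` value after a launch of the program `i` on a platform with the STM `s`. -/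
abbrev launchPcr (i s : Term) : Term := h (tup ![pd, tup ![h i, h s]])

/-- The platform state in which a launch on the platform `s` starts the program `i`. -/
@[simp]
def Platform.launched (s : Platform) (i : Term) : Platform :=
  { s with pcr := launchPcr i s.stm, init := i, lock := tt }

/-- The invariant of the platform states that the attacker learns: no state in which the CPU has
just reset the `PCR` or measured the trusted programs, and code integrity. -/
structure Platform.Ok (s : Platform) : Prop where
  ne_pd : s.pcr ≠ pd
  ne_launch : s.pcr ≠ launchPcr (prog Tinit) (prog Tstm)
  of_hchain : s.pcr = hchain →
    s.stm = prog Tstm ∧ s.init = prog Tinit ∧ s.pp = prog Tpp ∧ s.lock = tt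

namespace Platform.Ok

variable {s : Platform}

theorem ps (hs : s.pcr = DRT.ps) : s.Ok := by
  constructor <;> simp [hs, hchain]

theorem extend {s' : Platform} (hs : s.Ok) {v : Term} (hs' : s'.pcr = h (tup ![s.pcr, v])) :
    s'.Ok := by
  have hpd := hs.ne_pd
  have hlaunch := hs.ne_launch
  constructor <;> simp_all [hchain]

theorem of_pcr_ne {s' : Platform} (hs : s.Ok) (hs' : s'.pcr = s.pcr) (hne : s.pcr ≠ hchain) :
    s'.Ok where
  ne_pd := hs' ▸ hs.ne_pd
  ne_launch := hs' ▸ hs.ne_launch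
  of_hchain heq := (hne (hs' ▸ heq)).elim

end Platform.Ok

/-- An upper bound on the normal forms that the attacker can deduce. -/
inductive Known (ρ : Roles) : Term → Prop
  | var (x : Var) : Known ρ (.var x)
  | name {n : ℕ} : ρ n ≠ .free → ρ n ≠ .key → Known ρ (.name n)
  | app {f : Sym} {ts : Fin f.arity → Term} : ¬ f.IsPrivate → (∀ i, Known ρ (ts i)) →
      Known ρ (.app f ts)
  | hash (a : Term) : Known ρ (h a)
  | senc {a : Term} (b : Term) : Known ρ a → Known ρ (senc a b)
  | sealed (a : Term) : Known ρ (sealData a hchain)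
  | entry (i : ℕ) : Known ρ (prog (K (.entry i)))
  | tpm_ch {e : Term} : Known ρ e → Known ρ (tpm_ch (prog e))
  | state {s : Platform} : (∀ T ∈ s.components, Known ρ T) → s.Ok → Known ρ s.term

namespace Known

variable {ρ ρ' : Roles}

theorem mono (hρ : ρ.Ext ρ') {T : Term} (hT : Known ρ T) : Known ρ' T := by
  induction hT with
  | var x => exact .var x
  | name hfree hkey => exact .name (hρ _ hfree ▸ hfree) (hρ _ hfree ▸ hkey)
  | app hf _ ih => exact .app hf ih
  | hash a => exact .hash a
  | senc b _ ih => exact .senc b ih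
  | sealed a => exact .sealed a
  | entry i => exact .entry i
  | tpm_ch _ ih => exact .tpm_ch ih
  | state _ hs ih => exact .state ih hs

theorem const {f : Sym} (hf : f.arity = 0) (hpub : ¬ f.IsPrivate) : Known ρ (K f hf) :=
  .app hpub fun i => absurd i.isLt (by omega)

theorem not_const {f : Sym} (hf : f.arity = 0) (hpriv : f.IsPrivate) : ¬ Known ρ (K f hf) := by
  intro hT
  generalize hU : K f hf = U at hT
  cases hT
  case app hpub _ => cases hU; exact hpub hpriv
  case var | name => nomatch hU
  all_goals injection hU with hf'; simp [hf'] at hf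

theorem tup_iff {n : ℕ} {ts : Fin n → Term} : Known ρ (tup ts) ↔ ∀ i, Known ρ (ts i) := by
  refine ⟨fun hT => ?_, .app (f := .tup n) id⟩
  generalize hU : tup ts = U at hT
  cases hT
  case app hts => cases hU; exact hts
  all_goals nomatch hU

theorem of_senc {a b : Term} (hT : Known ρ (DRT.senc a b)) : Known ρ a := by
  generalize hU : DRT.senc a b = U at hT
  cases hT
  case app hts => cases hU; exact hts (0 : Fin 2)
  all_goals simp_all

theorem of_sealData {a b : Term} (hT : Known ρ (sealData a b)) : Known ρ a ∨ b = hchain := by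
  generalize hU : sealData a b = U at hT
  cases hT
  case app hts => cases hU; exact .inl (hts (0 : Fin 2))
  all_goals simp_all

theorem of_prog {a : Term} (hT : Known ρ (prog a)) : Known ρ a ∨ ∃ i, a = K (.entry i) := by
  generalize hU : prog a = U at hT
  cases hT
  case app hts => cases hU; exact .inl (hts (0 : Fin 1))
  case entry i => exact .inr ⟨i, by simpa using hU⟩
  all_goals nomatch hU

theorem of_tpm_ch {a : Term} (hT : Known ρ (DRT.tpm_ch a)) : ∃ e, a = prog e ∧ Known ρ e := by
  generalize hU : DRT.tpm_ch a = U at hT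
  cases hT
  case app hpub _ => cases hU; exact (hpub trivial).elim
  case tpm_ch e he => exact ⟨e, by simpa using hU, he⟩
  all_goals nomatch hU

theorem of_state {a b c d : Term} (hT : Known ρ (DRT.state a b c d)) :
    ∃ s : Platform, DRT.state a b c d = s.term ∧ (∀ T ∈ s.components, Known ρ T) ∧ s.Ok := by
  generalize hU : DRT.state a b c d = U at hT
  cases hT
  case app hpub _ => cases hU; exact (hpub trivial).elim
  case state s hcomp hs => exact ⟨s, rfl, hcomp, hs⟩
  all_goals nomatch hU

theorem not_key {n : ℕ} (hT : Known ρ (.name n)) : ρ n ≠ .key := by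
  cases hT
  assumption

theorem not_tpm_acc : ¬ Known ρ tpm_acc := not_const _ trivial

theorem not_cpu_acc : ¬ Known ρ cpu_acc := not_const _ trivial

theorem not_cpu_tpm : ¬ Known ρ cpu_tpm := not_const _ trivial

theorem not_entry (i : ℕ) : ¬ Known ρ (K (.entry i)) := not_const _ trivial

theorem not_tpm_ch_entry (i : ℕ) : ¬ Known ρ (DRT.tpm_ch (prog (K (.entry i)))) := by
  intro hc
  obtain ⟨e, he, hknown⟩ := hc.of_tpm_ch
  obtain rfl : K (.entry i) = e := by simpa using he
  exact not_entry i hknown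

end Known

theorem Edata.known {ρ : Roles} {f : Sym} {ts : Fin f.arity → Term} {W : Term}
    (hE : Edata (.app f ts) W) (hf : ¬ f.IsPrivate) (hts : ∀ i, Known ρ (ts i)) : Known ρ W := by
  generalize hU : Term.app f ts = U at hE
  cases hE <;> cases hU
  · exact (hts (0 : Fin 2)).of_senc
  · exact (hf trivial).elim

theorem Eprog.isPrivate {f : Sym} {ts : Fin f.arity → Term} {W : Term}
    (hE : Eprog (.app f ts) W) : f.IsPrivate := by
  generalize hU : Term.app f ts = U at hE
  cases hE
  cases hU
  trivial

/-- Without `cpu_acc`, the components of a state that code integrity speaks about can only be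
changed by programs stored in that state, and these are private once the `PCR` is `hchain`. -/
theorem Estate.known {ρ : Roles} {f : Sym} {ts : Fin f.arity → Term} {W : Term}
    (hE : Estate (.app f ts) W) (hts : ∀ i, Known ρ (ts i)) : Known ρ W := by
  generalize hU : Term.app f ts = U at hE
  cases hE <;> cases hU <;>
    obtain ⟨⟨_, _, _, _, _, _, _, _⟩, hs, hcomp, hok⟩ := Known.of_state (hts ⟨0, by decide⟩) <;>
    simp only [Platform.term, Term.app.injEq, heq_eq_eq, Matrix.vecCons_inj, true_and] at hs <;>
    simp only [Fin.forall_fin_succ, Matrix.cons_val_zero, Matrix.cons_val_succ] at hts <;>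
    simp only [Platform.components, List.forall_mem_cons] at hcomp <;>
    casesm* _ ∧ _ <;> subst_vars
  case' reset_pd | extend | set_pcr => exact absurd ‹_› Known.not_tpm_acc
  case' set_int_cpu | set_init | set_pp_cpu | set_lock_cpu => exact absurd ‹_› Known.not_cpu_acc
  case' reset_ps | set_int_pp | set_cache | flush_stm | flush_smi | set_pp_init | set_pp_smi |
      set_lock_pp | set_lock_smi =>
    refine .state (s := ⟨_, _, _, _, _, _, _, _⟩)
      (by simp only [Platform.components, List.forall_mem_cons, *]; simp) ?_
  case reset_ps => exact .ps rfl
  case set_int_pp | set_cache | flush_smi => exact ⟨hok.1, hok.2, hok.3⟩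
  case flush_stm => exact hok.of_pcr_ne rfl fun heq => nomatch (hok.of_hchain heq).2.2.2
  case set_pp_init =>
    refine hok.of_pcr_ne rfl fun heq => ?_
    have hentry : _ = prog Tinit := (hok.of_hchain heq).2.1
    simp_all [Known.not_entry]
  case set_lock_pp =>
    refine hok.of_pcr_ne rfl fun heq => ?_
    have hentry : _ = prog Tpp := (hok.of_hchain heq).2.2.1
    simp_all [Known.not_entry]
  case set_pp_smi | set_lock_smi =>
    refine hok.of_pcr_ne rfl fun heq => ?_
    have hentry : _ = prog Tstm := (hok.of_hchain heq).1
    simp_all [Known.not_entry, Known.tup_iff]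
  all_goals assumption

theorem Known.contract {ρ : Roles} {f : Sym} {ts : Fin f.arity → Term} (hf : ¬ f.IsPrivate)
    (hts : ∀ i, Known ρ (ts i)) : Known ρ (Term.app f ts).contract := by
  rcases Term.edrt_contract_or_not_edrt (.app f ts) with (hE | hE | hE) | ⟨-, hE⟩
  exacts [hE.known hf hts, (hf hE.isPrivate).elim, hE.known hts, hE.symm ▸ .app hf hts]

theorem Deduces.known_nf {ρ : Roles} {M : Set Term} (hM : ∀ T ∈ M, Known ρ T.nf) {T : Term}
    (hT : Deduces Edrt M T) : Known ρ T.nf := by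
  induction hT with
  | ax hT hE => exact eqE_iff.1 hE ▸ hM _ hT
  | app hf _ hE ih => exact eqE_iff.1 hE ▸ Known.contract hf ih
  | proj i _ hE ih =>
    rw [Term.nf, eval_constructor _ rfl] at ih
    exact eqE_iff.1 hE ▸ Known.tup_iff.1 ih i

theorem Term.IsPublic.known_eval {ρ : Roles} {v : Subst} (hv : ∀ x, Known ρ (v x)) {T : Term}
    (hT : T.IsPublic) (hnames : ∀ n ∈ T.names, Known ρ (.name n)) : Known ρ (T.eval v) := by
  induction T with
  | var x => exact hv x
  | name n => exact hnames n rfl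
  | app f ts ih =>
    exact .contract hT.1 fun i => ih i (hT.2 i) fun n hn => hnames n (Set.mem_iUnion.2 ⟨i, hn⟩)

/-! ### Messages on private channels -/

/-- The messages `T` that may be sent on a channel `c` that the attacker does not know. The channels
are `cpu_tpm`, the channels between the TPM and the trusted programs, and the entry points of
programs, of which only `Tinit` and `Tpp` are ever listened to. -/
inductive PrivMsg (ρ : Roles) : Term → Term → Prop
  | reset_req {n : ℕ} {s : Platform} {m : Term} : ρ n = .launch s m →
      PrivMsg ρ cpu_tpm (tup ![K .reset_req, .name n, s.term])
  | reset_resp {n : ℕ} {s : Platform} {m : Term} : ρ n = .launch s m →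
      PrivMsg ρ cpu_tpm (tup ![K .reset_resp, .name n, { s with pcr := pd }.term])
  | extend_req {n : ℕ} {s : Platform} {m : Term} : ρ n = .launch s m →
      PrivMsg ρ cpu_tpm (tup ![K .extend_req, .name n, { s with pcr := pd }.term, m])
  | extend_resp {n : ℕ} {s : Platform} {m : Term} : ρ n = .launch s m →
      PrivMsg ρ cpu_tpm
        (tup ![K .extend_resp, .name n, { s with pcr := h (tup ![pd, m]) }.term])
  | ext_channel (a : Term) : PrivMsg ρ cpu_tpm (tup ![K .ext_channel, tpm_ch a])
  | init_req {n : ℕ} {s : Platform} {m : Term} : ρ n = .init s m →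
      PrivMsg ρ (tpm_ch (prog Tinit)) (tup ![K .extend_req, .name n, s.term, m])
  | init_resp {n : ℕ} {s : Platform} {m : Term} : ρ n = .init s m →
      PrivMsg ρ (tpm_ch (prog Tinit))
        (tup ![K .extend_resp, .name n, { s with pcr := h (tup ![s.pcr, m]) }.term])
  | unsealing (a : Term) : PrivMsg ρ (tpm_ch (prog Tpp)) (tup ![K .tag_unsealing, a])
  | plain (a : Term) : PrivMsg ρ (tpm_ch (prog Tpp)) (tup ![K .tag_plain, a])
  | pp_req (a : Term) {s : Term} : Known ρ s →
      PrivMsg ρ (tpm_ch (prog Tpp)) (tup ![K .extend_req, a, s, bot])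
  | pp_resp (a : Term) {y b c d : Term} : Known ρ (state (tpm (h (tup ![y, bot]))) b c d) →
      PrivMsg ρ (tpm_ch (prog Tpp))
        (tup ![K .extend_resp, a, state (tpm (h (tup ![y, bot]))) b c d])
  | launch (a : Term) {s : Platform} {p : Term} : (∀ T ∈ s.components, Known ρ T) → Known ρ p →
      PrivMsg ρ Tinit (tup ![a, (s.launched (prog Tinit)).term, tpm_ch (prog Tinit), p])
  | drt_resp (a b : Term) {s : Term} : Known ρ s → PrivMsg ρ Tinit (tup ![a, b, s])
  | launch_other {j : ℕ} (hj : j ≠ 0) (a b c d : Term) :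
      PrivMsg ρ (K (.entry j)) (tup ![a, b, c, d])
  | run {s : Term} : Known ρ s → PrivMsg ρ Tpp (tup ![s, tpm_ch (prog Tpp)])
  | run_other {j : ℕ} (hj : j ≠ 1) (a b : Term) : PrivMsg ρ (K (.entry j)) (tup ![a, b])

/-- `T` may be sent on the channel `c`. -/
def MsgOk (ρ : Roles) (c T : Term) : Prop := (Known ρ c ∧ Known ρ T) ∨ PrivMsg ρ c T

section Messages

variable {ρ ρ' : Roles} {c T : Term}

theorem PrivMsg.mono (hρ : ρ.Ext ρ') (hT : PrivMsg ρ c T) : PrivMsg ρ' c T := by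
  cases hT with
  | reset_req hn => exact .reset_req (hρ.apply_eq hn nofun)
  | reset_resp hn => exact .reset_resp (hρ.apply_eq hn nofun)
  | extend_req hn => exact .extend_req (hρ.apply_eq hn nofun)
  | extend_resp hn => exact .extend_resp (hρ.apply_eq hn nofun)
  | ext_channel a => exact .ext_channel a
  | init_req hn => exact .init_req (hρ.apply_eq hn nofun)
  | init_resp hn => exact .init_resp (hρ.apply_eq hn nofun)
  | unsealing a => exact .unsealing a
  | plain a => exact .plain a
  | pp_req a hs => exact .pp_req a (hs.mono hρ)
  | pp_resp a hs => exact .pp_resp a (hs.mono hρ)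
  | launch a hs hp => exact .launch a (fun U hU => (hs U hU).mono hρ) (hp.mono hρ)
  | drt_resp a b hs => exact .drt_resp a b (hs.mono hρ)
  | launch_other hj a b c d => exact .launch_other hj a b c d
  | run hs => exact .run (hs.mono hρ)
  | run_other hj a b => exact .run_other hj a b

theorem PrivMsg.not_known (hT : PrivMsg ρ c T) : ¬ Known ρ c := by
  cases hT
  all_goals first
    | exact Known.not_cpu_tpm
    | exact Known.not_entry _
    | exact Known.not_tpm_ch_entry _

theorem MsgOk.mono (hρ : ρ.Ext ρ') (hT : MsgOk ρ c T) : MsgOk ρ' c T :=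
  hT.imp (fun ⟨hc, hT⟩ => ⟨hc.mono hρ, hT.mono hρ⟩) (·.mono hρ)

theorem MsgOk.known (hT : MsgOk ρ c T) (hc : Known ρ c) : Known ρ T :=
  (hT.resolve_right fun hpriv => hpriv.not_known hc).2

theorem MsgOk.privMsg (hT : MsgOk ρ c T) (hc : ¬ Known ρ c) : PrivMsg ρ c T :=
  hT.resolve_left fun hknown => hc hknown.1

end Messages

/-! ### Safe processes -/

/-- Under the valuation `v`, the process sends only admissible messages as long as it receives only
admissible messages, and it can give a role to every name that it restricts; the name `k_pp` gets
the role `key`. -/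
def Safe : Proc → Roles → Subst → Prop
  | .nil, _, _ => True
  | .par P Q, ρ, v => Safe P ρ v ∧ Safe Q ρ v
  | .repl P, ρ, v => Safe P ρ v
  | .new x P, ρ, v => ∀ ρ', ρ.Ext ρ' → ∀ n, ρ' n = .free →
      ∃ r, (x = .kpp → P = DATA_body → r = .key) ∧
        Safe P (Function.update ρ' n r) (Function.update v x (.name n))
  | .inp U A P, ρ, v => ∀ ρ', ρ.Ext ρ' → ∀ v' : Subst, (∀ x, x ∉ A.binds → v' x = v x) →
      MsgOk ρ' (U.eval v) (A.toTerm.eval v') → Safe P ρ' v'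
  | .out U T P, ρ, v => MsgOk ρ (U.eval v) (T.eval v) ∧ Safe P ρ v
  | .ite U W P Q, ρ, v =>
      (U.eval v = W.eval v → Safe P ρ v) ∧ (U.eval v ≠ W.eval v → Safe Q ρ v)
  | .letIn x T P, ρ, v =>
      NoDestructor Edrt (T.eval v) → Safe P ρ (Function.update v x (T.eval v))

theorem Safe.mono {ρ ρ' : Roles} (hρ : ρ.Ext ρ') {P : Proc} {v : Subst} (hP : Safe P ρ v) :
    Safe P ρ' v := by
  induction P generalizing v with
  | nil => trivial
  | par P Q ihP ihQ => exact ⟨ihP hP.1, ihQ hP.2⟩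
  | repl P ih => exact ih hP
  | new x P => exact fun ρ'' hρ' => hP ρ'' (hρ.trans hρ')
  | inp U A P => exact fun ρ'' hρ' => hP ρ'' (hρ.trans hρ')
  | out U T P ih => exact ⟨hP.1.mono hρ, ih hP.2⟩
  | ite U W P Q ihP ihQ => exact ⟨fun heq => ihP (hP.1 heq), fun hne => ihQ (hP.2 hne)⟩
  | letIn x T P ih => exact fun hT => ih (hP hT)

/-- The normal forms of the values of a substitution. -/
noncomputable def Subst.nf (σ : Subst) : Subst := fun x => (σ x).nf

theorem nf_subst (σ : Subst) (T : Term) : (T.subst σ).nf = T.eval σ.nf := eval_subst _ σ T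

theorem Subst.nf_update (σ : Subst) (x : Var) {T : Term} (hT : Irred Edrt T) :
    Subst.nf (Function.update σ x T) = Function.update σ.nf x T := by
  funext y
  by_cases hy : y = x
  · subst hy
    simp [Subst.nf, hT.nf_eq]
  · simp [Subst.nf, hy]

/-- The invariant of executions: fresh names have no role yet, the revealed terms are known, and
the running processes are safe. -/
structure Config.Ok (ρ : Roles) (C : Config) : Prop where
  free : ∀ n, n ∉ C.N → ρ n = .free
  known : ∀ T ∈ C.M, Known ρ T.nf
  safe : ∀ p ∈ C.procs, Safe p.2 ρ p.1.nf

namespace Config.Ok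

variable {ρ : Roles} {C C' : Config}

theorem new {N : Set ℕ} {M : Set Term} {Ps : Multiset (Subst × Proc)} {σ : Subst} {x : Var}
    {P : Proc} (hC : Config.Ok ρ ⟨N, M, (σ, .new x P) ::ₘ Ps⟩) {n : ℕ} (hn : n ∉ N) :
    ∃ ρ', (x = .kpp → P = DATA_body → ρ' n = .key) ∧ ρ.Ext ρ' ∧
      Config.Ok ρ' ⟨N ∪ {n}, M, (Function.update σ x (.name n), P) ::ₘ Ps⟩ := by
  obtain ⟨hP, hPs⟩ := Multiset.forall_mem_cons.1 hC.safe
  have hfree := hC.free n hn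
  obtain ⟨r, hkey, hsafe⟩ := hP ρ (.refl ρ) n hfree
  have hext := Roles.ext_update hfree r
  have hname : Irred Edrt (.name n) := irred_nf (.name n)
  refine ⟨_, fun hx hP => by simpa using hkey hx hP, hext, fun k hk => ?_,
    fun T hT => (hC.known T hT).mono hext,
    Multiset.forall_mem_cons.2 ⟨?_, fun p hp => (hPs p hp).mono hext⟩⟩
  · simp only [Set.union_singleton, Set.mem_insert_iff, not_or] at hk
    rw [Function.update_of_ne hk.1]
    exact hC.free k hk.2
  · exact Subst.nf_update σ x hname ▸ hsafe

theorem comm {N : Set ℕ} {M : Set Term} {Ps : Multiset (Subst × Proc)} {σ τ τ' : Subst}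
    {U U' T : Term} {A : Pat} {P Q : Proc}
    (hC : Config.Ok ρ ⟨N, M, (σ, .out U T P) ::ₘ (τ, .inp U' A Q) ::ₘ Ps⟩)
    (hU : EqE Edrt (U.subst σ) (U'.subst τ)) (hA : Matches Edrt τ A (T.subst σ) τ') :
    Config.Ok ρ ⟨N, M ∪ {T' | Deduces Edrt M (U.subst σ) ∧ T' = T.subst σ},
      (σ, P) ::ₘ (τ', Q) ::ₘ Ps⟩ := by
  have hsafe := hC.safe
  simp only [Multiset.forall_mem_cons] at hsafe
  obtain ⟨⟨hmsg, hP⟩, hQ, hPs⟩ := hsafe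
  obtain ⟨hfix, hirred, hT⟩ := hA
  refine ⟨hC.free, ?_, ?_⟩
  · rintro W (hW | ⟨hd, rfl⟩)
    · exact hC.known W hW
    · rw [nf_subst]
      exact hmsg.known (nf_subst σ U ▸ hd.known_nf hC.known)
  · simp only [Multiset.forall_mem_cons]
    refine ⟨hP, hQ ρ (.refl ρ) τ'.nf (fun x hx => congrArg Term.nf (hfix x hx)) ?_, hPs⟩
    rw [eqE_iff, nf_subst, nf_subst] at hU hT
    exact hU ▸ hT ▸ hmsg

theorem step (hC : C.Ok ρ) (hS : Step Edrt C C') : ∃ ρ', ρ.Ext ρ' ∧ C'.Ok ρ' := by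
  have hsafe := hC.safe
  cases hS with
  | new N M Ps σ x P n hn =>
    obtain ⟨ρ', -, hρ', hC'⟩ := hC.new hn
    exact ⟨ρ', hρ', hC'⟩
  | comm N M Ps σ U T P τ U' A Q τ' hU hA => exact ⟨ρ, .refl ρ, hC.comm hU hA⟩
  | letIn N M Ps σ x T P T' hT hN =>
    simp only [Multiset.forall_mem_cons, Safe, ← nf_subst, isNormalForm_iff.1 hT] at hsafe
    refine ⟨ρ, .refl ρ, hC.free, hC.known, Multiset.forall_mem_cons.2 ⟨?_, hsafe.2⟩⟩
    rw [Subst.nf_update σ x hT.2]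
    exact hsafe.1 hN
  | nil | bang | par | ifTrue | ifFalse =>
    refine ⟨ρ, .refl ρ, hC.free, hC.known, ?_⟩
    simp only [Multiset.forall_mem_cons] at hsafe ⊢
    simp_all [Safe, eqE_iff, nf_subst]

theorem steps (hC : C.Ok ρ) (hS : Steps Edrt C C') : ∃ ρ', ρ.Ext ρ' ∧ C'.Ok ρ' := by
  induction hS with
  | refl => exact ⟨ρ, .refl ρ, hC⟩
  | tail _ hS ih =>
    obtain ⟨ρ₁, hρ₁, hC₁⟩ := ih
    obtain ⟨ρ₂, hρ₂, hC₂⟩ := hC₁.step hS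
    exact ⟨ρ₂, hρ₁.trans hρ₂, hC₂⟩

end Config.Ok

/-! ### The attacker -/

theorem Known.of_pat {ρ : Roles} {v : Subst} {A : Pat} (hA : Known ρ (A.toTerm.eval v)) {x : Var}
    (hx : x ∈ A.binds) : Known ρ (v x) := by
  induction A with
  | bind y =>
    cases hx
    exact hA
  | test T => exact hx.elim
  | tup As ih =>
    obtain ⟨i, hi⟩ := Set.mem_iUnion.1 hx
    rw [Pat.toTerm, eval_constructor v rfl] at hA
    exact ih i (Known.tup_iff.1 hA i) hi

theorem Known.update {ρ : Roles} {v : Subst} (hv : ∀ y, Known ρ (v y)) {T : Term} (hT : Known ρ T)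
    (x y : Var) : Known ρ (Function.update v x T y) := by
  rcases eq_or_ne y x with rfl | hy
  · rwa [Function.update_self]
  · rw [Function.update_of_ne hy]
    exact hv y

theorem not_isPublic_DATA_body : ¬ DATA_body.IsPublic := by
  intro hP
  have hseal : (sealData (V .kpp) hchain).IsPublic := hP.2.2.1
  have hTpp : (h (prog Tpp)).IsPublic := ((hseal.2 (1 : Fin 2)).2 (0 : Fin 1)).2 (1 : Fin 2)
  exact ((hTpp.2 (0 : Fin 1)).2 (0 : Fin 1)).1 trivial

theorem Proc.IsPublic.safe {P : Proc} (hP : P.IsPublic) {ρ : Roles} {v : Subst}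
    (hv : ∀ x, Known ρ (v x)) (hn : ∀ n ∈ P.names, Known ρ (.name n)) : Safe P ρ v := by
  induction P generalizing ρ v with
  | nil => trivial
  | par P Q ihP ihQ =>
    exact ⟨ihP hP.1 hv fun n hnP => hn n (.inl hnP), ihQ hP.2 hv fun n hnQ => hn n (.inr hnQ)⟩
  | repl P ih => exact ih hP hv hn
  | new x P ih =>
    intro ρ' hρ n hfree
    have hext := hρ.trans (Roles.ext_update hfree .pub)
    have hname : Known (Function.update ρ' n .pub) (.name n) := .name (by simp) (by simp)
    exact ⟨.pub, fun _ hPeq => (not_isPublic_DATA_body (hPeq ▸ hP)).elim,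
      ih hP (.update (fun y => (hv y).mono hext) hname x) fun k hk => (hn k hk).mono hext⟩
  | inp U A P ih =>
    intro ρ' hρ v' hfix hmsg
    have hU : Known ρ (U.eval v) := hP.1.known_eval hv fun n hnU => hn n (.inl (.inl hnU))
    have hA := hmsg.known (hU.mono hρ)
    refine ih hP.2.2 (fun x => ?_) fun n hnP => (hn n (.inr hnP)).mono hρ
    by_cases hx : x ∈ A.binds
    · exact hA.of_pat hx
    · exact hfix x hx ▸ (hv x).mono hρ
  | out U T P ih =>
    exact ⟨.inl ⟨hP.1.known_eval hv fun n hnU => hn n (.inl (.inl hnU)),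
      hP.2.1.known_eval hv fun n hnT => hn n (.inl (.inr hnT))⟩,
      ih hP.2.2 hv fun n hnP => hn n (.inr hnP)⟩
  | ite U W P Q ihP ihQ =>
    exact ⟨fun _ => ihP hP.2.2.1 hv fun n hnP => hn n (.inl (.inr hnP)),
      fun _ => ihQ hP.2.2.2 hv fun n hnQ => hn n (.inr hnQ)⟩
  | letIn x T P ih =>
    have hT : Known ρ (T.eval v) := hP.1.known_eval hv fun n hnT => hn n (.inl hnT)
    exact fun _ => ih hP.2 (.update hv hT x) fun n hnP => hn n (.inr hnP)

/-! ### Inversion of rewrite rules and messages -/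

section Rules

variable {a b c W : Term}

theorem Edrt.inv_reset (hE : Edrt (reset a b c) W) :
    ∃ y x₁ x₂ x₃, a = state (tpm y) x₁ x₂ x₃ ∧ W = state (tpm c) x₁ x₂ x₃ := by
  generalize hU : reset a b c = U at hE
  rcases hE with hE | hE | hE <;> cases hE <;> simp_all

theorem Edrt.inv_extend (hE : Edrt (extend a b c) W) :
    ∃ y x₁ x₂ x₃, a = state (tpm y) x₁ x₂ x₃ ∧ W = state (tpm (h (tup ![y, c]))) x₁ x₂ x₃ := by
  generalize hU : extend a b c = U at hE
  rcases hE with hE | hE | hE <;> cases hE <;> simp_all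

theorem Edrt.inv_get_entry (hE : Edrt (get_entry a) W) : a = prog W := by
  generalize hU : get_entry a = U at hE
  rcases hE with hE | hE | hE <;> cases hE <;> simp_all

theorem Edrt.inv_unsealData (hE : Edrt (unsealData a b) W) : a = sealData W b := by
  generalize hU : unsealData a b = U at hE
  rcases hE with hE | hE | hE <;> cases hE <;> simp_all

theorem Edrt.inv_sdec (hE : Edrt (sdec a b) W) : a = senc W b := by
  generalize hU : sdec a b = U at hE
  rcases hE with hE | hE | hE <;> cases hE <;> simp_all

theorem Edrt.inv_lock (hE : Edrt (lock a) W) :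
    ∃ x₁ x₂ x₃ y₁ y₂, a = state x₁ x₂ x₃ (drt y₁ y₂ W) := by
  generalize hU : lock a = U at hE
  rcases hE with hE | hE | hE <;> cases hE <;> simp_all

theorem Edrt.inv_pcr (hE : Edrt (pcr a) W) : ∃ x₁ x₂ x₃, a = state (tpm W) x₁ x₂ x₃ := by
  generalize hU : pcr a = U at hE
  rcases hE with hE | hE | hE <;> cases hE <;> simp_all

theorem Edrt.inv_set_int_Tpp (hE : Edrt (set_int a Tpp c) W) :
    ∃ x₁ y z x₂ z₁, a = state x₁ (cpu y z) x₂ (drt z₁ (prog Tpp) tt) ∧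
      W = state x₁ (cpu c z) x₂ (drt z₁ (prog Tpp) tt) := by
  generalize hU : set_int a Tpp c = U at hE
  rcases hE with hE | hE | hE <;> cases hE <;> simp_all

theorem Edrt.inv_set_lock_Tpp (hE : Edrt (set_lock a Tpp c) W) :
    ∃ x₁ x₂ x₃ y₁ y₂ y₃, a = state x₁ x₂ x₃ (drt y₁ y₂ y₃) ∧
      W = state x₁ x₂ x₃ (drt y₁ y₂ c) := by
  generalize hU : set_lock a Tpp c = U at hE
  rcases hE with hE | hE | hE <;> cases hE <;> simp_all

end Rules

section PrivMsg

variable {ρ : Roles} {a b c s x : Term}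

theorem PrivMsg.inv_reset_req (hT : PrivMsg ρ cpu_tpm (tup ![K .reset_req, a, s])) :
    ∃ n t m, a = .name n ∧ s = t.term ∧ ρ n = .launch t m := by
  generalize hc : cpu_tpm = c at hT
  generalize hU : tup ![K .reset_req, a, s] = U at hT
  cases hT <;> simp_all

theorem PrivMsg.inv_reset_resp (hT : PrivMsg ρ cpu_tpm (tup ![K .reset_resp, a, s])) :
    ∃ n t m, a = .name n ∧ s = { t with pcr := pd }.term ∧ ρ n = .launch t m := by
  generalize hc : cpu_tpm = c at hT
  generalize hU : tup ![K .reset_resp, a, s] = U at hT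
  cases hT <;> simp_all

theorem PrivMsg.inv_extend_req (hT : PrivMsg ρ cpu_tpm (tup ![K .extend_req, a, s, b])) :
    ∃ n t, a = .name n ∧ s = { t with pcr := pd }.term ∧ ρ n = .launch t b := by
  generalize hc : cpu_tpm = c at hT
  generalize hU : tup ![K .extend_req, a, s, b] = U at hT
  cases hT <;> simp_all

theorem PrivMsg.inv_extend_resp (hT : PrivMsg ρ cpu_tpm (tup ![K .extend_resp, a, s])) :
    ∃ n t m, a = .name n ∧ s = { t with pcr := h (tup ![pd, m]) }.term ∧ ρ n = .launch t m := by
  generalize hc : cpu_tpm = c at hT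
  generalize hU : tup ![K .extend_resp, a, s] = U at hT
  cases hT <;> simp_all

theorem PrivMsg.inv_ext_channel (hT : PrivMsg ρ cpu_tpm (tup ![K .ext_channel, a])) :
    ∃ x, a = tpm_ch x := by
  generalize hc : cpu_tpm = c at hT
  generalize hU : tup ![K .ext_channel, a] = U at hT
  cases hT <;> simp_all

theorem PrivMsg.inv_tpm_ch_extend_req
    (hT : PrivMsg ρ (tpm_ch x) (tup ![K .extend_req, a, s, b])) :
    (x = prog Tinit ∧ ∃ n t, a = .name n ∧ s = t.term ∧ ρ n = .init t b) ∨
      (x = prog Tpp ∧ b = bot ∧ Known ρ s) := by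
  generalize hc : tpm_ch x = c at hT
  generalize hU : tup ![K .extend_req, a, s, b] = U at hT
  cases hT <;> simp_all

theorem PrivMsg.inv_init_resp
    (hT : PrivMsg ρ (tpm_ch (prog Tinit)) (tup ![K .extend_resp, a, s])) :
    ∃ n t m, a = .name n ∧ s = { t with pcr := h (tup ![t.pcr, m]) }.term ∧
      ρ n = .init t m := by
  generalize hc : tpm_ch (prog Tinit) = c at hT
  generalize hU : tup ![K .extend_resp, a, s] = U at hT
  cases hT <;> simp_all

theorem PrivMsg.inv_pp_resp
    (hT : PrivMsg ρ (tpm_ch (prog Tpp)) (tup ![K .extend_resp, a, s])) :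
    Known ρ s ∧ ∃ y x₁ x₂ x₃, s = state (tpm (h (tup ![y, bot]))) x₁ x₂ x₃ := by
  generalize hc : tpm_ch (prog Tpp) = c at hT
  generalize hU : tup ![K .extend_resp, a, s] = U at hT
  cases hT <;> simp_all

theorem PrivMsg.inv_unsealing (hT : PrivMsg ρ (tpm_ch x) (tup ![K .tag_unsealing, a])) :
    x = prog Tpp := by
  generalize hc : tpm_ch x = c at hT
  generalize hU : tup ![K .tag_unsealing, a] = U at hT
  cases hT <;> simp_all

theorem PrivMsg.inv_launch (hT : PrivMsg ρ Tinit (tup ![a, s, c, b])) :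
    ∃ t : Platform, (∀ T ∈ t.components, Known ρ T) ∧
      s = (t.launched (prog Tinit)).term ∧ c = tpm_ch (prog Tinit) ∧ Known ρ b := by
  generalize hc : Tinit = e at hT
  generalize hU : tup ![a, s, c, b] = U at hT
  cases hT
  case launch t _ ht _ => exact ⟨t, ht, by simp_all⟩
  all_goals simp_all

theorem PrivMsg.inv_drt_resp {i : ℕ} (hT : PrivMsg ρ (K (.entry i)) (tup ![a, b, s])) :
    Known ρ s := by
  generalize hc : K (.entry i) = c at hT
  generalize hU : tup ![a, b, s] = U at hT
  cases hT <;> simp_all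

theorem PrivMsg.inv_run (hT : PrivMsg ρ Tpp (tup ![s, c])) :
    c = tpm_ch (prog Tpp) ∧ Known ρ s := by
  generalize hc : Tpp = e at hT
  generalize hU : tup ![s, c] = U at hT
  cases hT <;> simp_all

end PrivMsg

/-! ### The trusted processes -/

@[simp]
theorem Pat.toTerm_bind (x : Var) : (Pat.bind x).toTerm = V x := rfl

@[simp]
theorem Pat.toTerm_test (T : Term) : (Pat.test T).toTerm = T := rfl

@[simp]
theorem Pat.toTerm_tup {n : ℕ} (As : Fin n → Pat) :
    (Pat.tup As).toTerm = DRT.tup (Pat.toTerm ∘ As) := rfl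

@[simp]
theorem Pat.binds_bind (x : Var) : (Pat.bind x).binds = {x} := rfl

@[simp]
theorem Pat.binds_test (T : Term) : (Pat.test T).binds = ∅ := rfl

@[simp]
theorem Pat.binds_tup_vecEmpty : (Pat.tup ![]).binds = ∅ := by
  simp [Pat.binds]

@[simp]
theorem Pat.binds_tup_vecCons {n : ℕ} (A : Pat) (As : Fin n → Pat) :
    (Pat.tup (Matrix.vecCons A As)).binds = A.binds ∪ (Pat.tup As).binds := by
  ext x
  simp [Pat.binds, Fin.exists_fin_succ]

section

variable {ρ : Roles} {v : Subst} {U : Term} {P : Proc}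

theorem safe_inp_bind {x : Var}
    (hP : ∀ ρ', ρ.Ext ρ' → ∀ T, MsgOk ρ' (U.eval v) T → Safe P ρ' (Function.update v x T)) :
    Safe (.inp U (.bind x) P) ρ v := by
  intro ρ' hρ v' hv hmsg
  obtain ⟨T, rfl⟩ : ∃ T, v' = Function.update v x T := by
    refine ⟨v' x, Function.eq_update_iff.mpr ?_⟩
    exact ⟨rfl, hv⟩
  exact hP ρ' hρ T (by simpa using hmsg)

theorem safe_inp_tag {f : Sym} {hf : f.arity = 0} {x : Var}
    (hP : ∀ ρ', ρ.Ext ρ' → ∀ T, MsgOk ρ' (U.eval v) (tup ![K f hf, T]) →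
      Safe P ρ' (Function.update v x T)) :
    Safe (.inp U (.tup ![.test (K f hf), .bind x]) P) ρ v := by
  intro ρ' hρ v' hv hmsg
  obtain ⟨T, rfl⟩ : ∃ T, v' = Function.update v x T := by
    refine ⟨v' x, Function.eq_update_iff.mpr ?_⟩
    exact ⟨rfl, by simpa using hv⟩
  exact hP ρ' hρ T (by simpa using hmsg)

theorem safe_inp_response {f : Sym} {hf : f.arity = 0} {x z : Var} (hxz : x ≠ z)
    (hP : ∀ ρ', ρ.Ext ρ' → ∀ T, MsgOk ρ' (U.eval v) (tup ![K f hf, v x, T]) →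
      Safe P ρ' (Function.update v z T)) :
    Safe (.inp U (.tup ![.test (K f hf), .test (V x), .bind z]) P) ρ v := by
  intro ρ' hρ v' hv hmsg
  obtain ⟨T, rfl⟩ : ∃ T, v' = Function.update v z T := by
    refine ⟨v' z, Function.eq_update_iff.mpr ?_⟩
    exact ⟨rfl, by simpa using hv⟩
  exact hP ρ' hρ T (by simpa [hxz] using hmsg)

theorem known_os : Known ρ os := .const rfl id

theorem known_tt : Known ρ tt := .const rfl id

theorem known_ff : Known ρ ff := .const rfl id

theorem known_bot : Known ρ bot := .const rfl id

theorem MsgOk.os {T : Term} (hT : Known ρ T) : MsgOk ρ os T := .inl ⟨known_os, hT⟩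

end

theorem safe_reset_exchange {ρ : Roles} {v : Subst} {P : Proc} {n : ℕ} {s : Platform} {m : Term}
    {x y z : Var} (hx : v x = .name n) (hy : v y = s.term) (hn : ρ n = .launch s m) (hxz : x ≠ z)
    (hP : ∀ ρ', ρ.Ext ρ' → Safe P ρ' (Function.update v z { s with pcr := pd }.term)) :
    Safe (.out cpu_tpm (tup ![K .reset_req, V x, V y]) <|
      .inp cpu_tpm (.tup ![.test (K .reset_resp), .test (V x), .bind z]) P) ρ v := by
  refine ⟨.inr (by simpa [hx, hy] using .reset_req hn), safe_inp_response hxz ?_⟩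
  intro ρ' hρ T hmsg
  simp only [eval_const, hx] at hmsg
  obtain ⟨k, s', m', hk, rfl, hr⟩ := (hmsg.privMsg Known.not_cpu_tpm).inv_reset_resp
  cases hk
  cases (hρ.apply_eq hn nofun).symm.trans hr
  exact hP ρ' hρ

theorem safe_extend_exchange {ρ : Roles} {v : Subst} {P : Proc} {n : ℕ} {s : Platform} {m : Term}
    {x y w z : Var} (hx : v x = .name n) (hy : v y = { s with pcr := pd }.term) (hw : v w = m)
    (hn : ρ n = .launch s m) (hxz : x ≠ z)
    (hP : ∀ ρ', ρ.Ext ρ' →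
      Safe P ρ' (Function.update v z { s with pcr := h (tup ![pd, m]) }.term)) :
    Safe (.out cpu_tpm (tup ![K .extend_req, V x, V y, V w]) <|
      .inp cpu_tpm (.tup ![.test (K .extend_resp), .test (V x), .bind z]) P) ρ v := by
  refine ⟨.inr (by simpa [hx, hy, hw] using .extend_req hn), safe_inp_response hxz ?_⟩
  intro ρ' hρ T hmsg
  simp only [eval_const, hx] at hmsg
  obtain ⟨k, s', m', hk, rfl, hr⟩ := (hmsg.privMsg Known.not_cpu_tpm).inv_extend_resp
  cases hk
  cases (hρ.apply_eq hn nofun).symm.trans hr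
  exact hP ρ' hρ

theorem safe_init_exchange {ρ : Roles} {v : Subst} {P : Proc} {n : ℕ} {s : Platform} {m : Term}
    {c x y w z : Var} (hc : v c = tpm_ch (prog Tinit)) (hx : v x = .name n) (hy : v y = s.term)
    (hw : v w = m) (hn : ρ n = .init s m) (hxz : x ≠ z)
    (hP : ∀ ρ', ρ.Ext ρ' →
      Safe P ρ' (Function.update v z { s with pcr := h (tup ![s.pcr, m]) }.term)) :
    Safe (.out (V c) (tup ![K .extend_req, V x, V y, V w]) <|
      .inp (V c) (.tup ![.test (K .extend_resp), .test (V x), .bind z]) P) ρ v := by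
  refine ⟨.inr (by simpa [hc, hx, hy, hw] using .init_req hn), safe_inp_response hxz ?_⟩
  intro ρ' hρ T hmsg
  simp only [eval_var, hc, hx] at hmsg
  obtain ⟨k, s', m', hk, rfl, hr⟩ := (hmsg.privMsg (Known.not_tpm_ch_entry 0)).inv_init_resp
  cases hk
  cases (hρ.apply_eq hn nofun).symm.trans hr
  exact hP ρ' hρ

/-! ### The TPM -/

section TPM

variable {ρ : Roles} {v : Subst} {a b c d y s W : Term}

theorem Known.reset_state (hs : Known ρ (DRT.state (tpm y) b c d)) :
    Known ρ (DRT.state (tpm ps) b c d) := by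
  obtain ⟨s, hs', hcomp, -⟩ := hs.of_state
  obtain ⟨-, rfl, rfl, rfl⟩ : y = s.pcr ∧ _ := by simpa using hs'
  exact .state (s := { s with pcr := ps })
    (List.forall_mem_cons.mpr ⟨.const rfl id, (List.forall_mem_cons.mp hcomp).2⟩) (.ps rfl)

theorem Known.extend_state (hs : Known ρ (DRT.state (tpm y) b c d)) (a : Term) :
    Known ρ (DRT.state (tpm (h (tup ![y, a]))) b c d) := by
  obtain ⟨s, hs', hcomp, hok⟩ := hs.of_state
  obtain ⟨rfl, rfl, rfl, rfl⟩ : y = s.pcr ∧ _ := by simpa using hs'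
  exact .state (s := { s with pcr := h (tup ![s.pcr, a]) })
    (List.forall_mem_cons.mpr ⟨.hash _, (List.forall_mem_cons.mp hcomp).2⟩) (hok.extend rfl)

theorem MsgOk.reset_resp (hc : c = cpu_tpm ∧ b = pd ∨ c = DRT.os ∧ b = ps)
    (hmsg : MsgOk ρ c (tup ![K .reset_req, a, s])) (hW : Edrt (reset s tpm_acc b) W) :
    MsgOk ρ c (tup ![K .reset_resp, a, W]) := by
  obtain ⟨y, x₁, x₂, x₃, rfl, rfl⟩ := hW.inv_reset
  rcases hc with ⟨rfl, rfl⟩ | ⟨rfl, rfl⟩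
  · obtain ⟨n, t, m, rfl, ht, hn⟩ := (hmsg.privMsg Known.not_cpu_tpm).inv_reset_req
    obtain ⟨-, rfl, rfl, rfl⟩ : y = t.pcr ∧ _ := by simpa using ht
    exact .inr (.reset_resp hn)
  · obtain ⟨-, ha, hs⟩ : _ ∧ Known ρ a ∧ Known ρ (state (tpm y) x₁ x₂ x₃) := by
      simpa [Known.tup_iff, Fin.forall_fin_succ] using hmsg.known known_os
    refine .os (Known.tup_iff.mpr ?_)
    simpa [Fin.forall_fin_succ, ha, hs.reset_state] using Known.const rfl id

theorem safe_PCR_RESET (hv : v .ch = cpu_tpm ∧ v .rv = pd ∨ v .ch = os ∧ v .rv = ps) :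
    Safe PCR_RESET ρ v := by
  intro ρ' _ v' hv' hmsg hN
  rw [← hv' .ch (by simp), ← hv' .rv (by simp)] at hv
  have hreq : MsgOk ρ' (v' .ch) (tup ![K .reset_req, v' .nonce, v' .pfState]) := by
    simpa [hv'] using hmsg
  have hreset : Edrt (reset (v' .pfState) tpm_acc (v' .rv)) _ :=
    edrt_contract (by simpa using hN)
  exact ⟨by simpa using hreq.reset_resp hv hreset, trivial⟩

theorem safe_TPM_RESET : Safe TPM_RESET ρ v :=
  ⟨fun _ _ => safe_PCR_RESET (by simp), fun _ _ => safe_PCR_RESET (by simp)⟩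

theorem MsgOk.extend_resp (hc : c = cpu_tpm ∨ c = DRT.os ∨ ∃ x, c = tpm_ch x)
    (hmsg : MsgOk ρ c (tup ![K .extend_req, a, s, b])) (hW : Edrt (extend s tpm_acc b) W) :
    MsgOk ρ c (tup ![K .extend_resp, a, W]) := by
  obtain ⟨y, x₁, x₂, x₃, rfl, rfl⟩ := hW.inv_extend
  rcases hmsg with ⟨hknown, hmsg⟩ | hmsg
  · obtain ⟨-, ha, hs, -⟩ : _ ∧ Known ρ a ∧ Known ρ (state (tpm y) x₁ x₂ x₃) ∧ _ := by
      simpa [Known.tup_iff, Fin.forall_fin_succ] using hmsg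
    refine .inl ⟨hknown, Known.tup_iff.mpr ?_⟩
    simpa [Fin.forall_fin_succ, ha, hs.extend_state] using Known.const rfl id
  rcases hc with rfl | rfl | ⟨x, rfl⟩
  · obtain ⟨n, t, rfl, ht, hn⟩ := hmsg.inv_extend_req
    obtain ⟨rfl, rfl, rfl, rfl⟩ : y = pd ∧ _ := by simpa using ht
    exact .inr (.extend_resp hn)
  · exact (hmsg.not_known known_os).elim
  · rcases hmsg.inv_tpm_ch_extend_req with ⟨rfl, n, t, rfl, ht, hn⟩ | ⟨rfl, rfl, hs⟩
    · obtain ⟨rfl, rfl, rfl, rfl⟩ : y = t.pcr ∧ _ := by simpa using ht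
      exact .inr (.init_resp hn)
    · exact .inr (.pp_resp a (hs.extend_state bot))

theorem safe_PCR_EXTEND (hv : v .ch = cpu_tpm ∨ v .ch = os ∨ ∃ x, v .ch = tpm_ch x) :
    Safe PCR_EXTEND ρ v := by
  intro ρ' _ v' hv' hmsg hN
  rw [← hv' .ch (by simp)] at hv
  have hreq : MsgOk ρ' (v' .ch) (tup ![K .extend_req, v' .nonce, v' .pfState, v' .val]) := by
    simpa [hv'] using hmsg
  have hextend : Edrt (extend (v' .pfState) tpm_acc (v' .val)) _ :=
    edrt_contract (by simpa using hN)
  exact ⟨by simpa using hreq.extend_resp hv hextend, trivial⟩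

theorem safe_TPM_EXTEND : Safe TPM_EXTEND ρ v := by
  refine ⟨fun _ => safe_PCR_EXTEND (.inl (by simp)),
    fun _ => safe_PCR_EXTEND (.inr (.inl (by simp))), safe_inp_tag fun ρ' _ T hmsg => ?_⟩
  simp only [eval_const] at hmsg
  obtain ⟨x, rfl⟩ := (hmsg.privMsg Known.not_cpu_tpm).inv_ext_channel
  exact safe_PCR_EXTEND (.inr (.inr ⟨x, by simp⟩))

theorem MsgOk.plain (hc : c = DRT.os ∨ ∃ x, c = tpm_ch x) (hb : b = hchain → c = tpm_ch (prog Tpp))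
    (hmsg : MsgOk ρ c (tup ![K .tag_unsealing, a])) (hW : Edrt (unsealData a b) W) :
    MsgOk ρ c (tup ![K .tag_plain, W]) := by
  obtain rfl := hW.inv_unsealData
  rcases hmsg with ⟨hknown, hmsg⟩ | hmsg
  · obtain ⟨-, ha⟩ : _ ∧ Known ρ (sealData W b) := by
      simpa [Known.tup_iff, Fin.forall_fin_succ] using hmsg
    rcases ha.of_sealData with hW' | rfl
    · refine .inl ⟨hknown, Known.tup_iff.mpr ?_⟩
      simpa [Fin.forall_fin_succ, hW'] using Known.const rfl id
    · exact (Known.not_tpm_ch_entry 1 (hb rfl ▸ hknown)).elim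
  · rcases hc with rfl | ⟨x, rfl⟩
    · exact (hmsg.not_known known_os).elim
    · obtain rfl := hmsg.inv_unsealing
      exact .inr (.plain W)

theorem safe_UNSEAL (hv : v .ch = os ∨ ∃ x, v .ch = tpm_ch x)
    (hpcr : (pcr (v .pfState)).contract = hchain → v .ch = tpm_ch (prog Tpp)) :
    Safe UNSEAL ρ v := by
  refine safe_inp_tag fun ρ' _ T hmsg hN => ⟨?_, trivial⟩
  have hunseal : Edrt (unsealData T (pcr (v .pfState)).contract) _ :=
    edrt_contract (by simpa using hN)
  simpa using MsgOk.plain hv hpcr (by simpa using hmsg) hunseal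

theorem Known.lock_pp_of_pcr (hs : Known ρ s) (hpcr : (pcr s).contract = hchain) :
    (lock s).contract = tt ∧ (pp s).contract = prog Tpp := by
  obtain ⟨x₁, x₂, x₃, rfl⟩ := (edrt_of_contract_eq hpcr (by simp [hchain])).inv_pcr
  obtain ⟨s, hs', -, hok⟩ := hs.of_state
  have hpcr' : s.pcr = hchain := by simp_all
  obtain ⟨-, -, hpp, hlock⟩ := hok.of_hchain hpcr'
  rw [hs']
  simpa [hpp, hlock] using
    And.intro (Edrt.contract_eq (.inr (.inr (.lock ..)))) (Edrt.contract_eq (.inr (.inr (.pp ..))))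

theorem safe_TPM_UNSEAL : Safe TPM_UNSEAL ρ v := by
  refine safe_inp_bind fun ρ' _ s hmsg => ?_
  have hs : Known ρ' s := MsgOk.known (c := os) (by simpa using hmsg) known_os
  refine ⟨fun _ _ => safe_UNSEAL (.inr ⟨_, by simp; rfl⟩) fun hpcr => ?_,
    fun hlock _ => safe_UNSEAL (.inl (by simp)) fun hpcr => ?_⟩
  · simpa using (hs.lock_pp_of_pcr (by simpa using hpcr)).2
  · exact (hlock (by simpa using (hs.lock_pp_of_pcr (by simpa using hpcr)).1)).elim

theorem safe_TPM : Safe TPM ρ v := ⟨safe_TPM_RESET, safe_TPM_EXTEND, safe_TPM_UNSEAL⟩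

end TPM

/-! ### Launch and execution -/

section Execution

variable {ρ : Roles} {v : Subst} {p s W b c d y : Term}

theorem safe_DATA : Safe DATA ρ v := by
  intro ρ₁ _ n _
  refine ⟨.key, fun _ _ => rfl, fun ρ₂ _ k _ => ⟨.pub, nofun, ?_, fun _ => ⟨?_, trivial⟩⟩⟩
  · have hk' : Known (Function.update ρ₂ k .pub) (.name k) := .name (by simp) (by simp)
    simpa using MsgOk.os (.senc (.name n) hk')
  · simpa using MsgOk.os (.sealed (.name n))

theorem safe_SETUP : Safe SETUP ρ v := by
  refine safe_inp_bind fun ρ₁ _ a ha => safe_inp_bind fun ρ₂ hρ₂ b hb => ⟨?_, ?_⟩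
  · have hstm : Known ρ₂ a := (MsgOk.known (by simpa using ha) known_os).mono hρ₂
    have hsmi : Known ρ₂ b := MsgOk.known (by simpa using hb) known_os
    simpa using MsgOk.os (.state (s := ⟨ps, tt, bot, a, b, bot, bot, ff⟩)
      (by simpa [hstm, hsmi, known_tt, known_bot, known_ff] using Known.const rfl id) (.ps rfl))
  refine safe_inp_bind fun ρ₃ _ i hi => safe_inp_bind fun ρ₄ hρ₄ p hp =>
    safe_inp_bind fun ρ₅ hρ₅ s hs => ⟨?_, trivial⟩
  have hi : Known ρ₅ i := (MsgOk.known (by simpa using hi) known_os).mono (hρ₄.trans hρ₅)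
  have hp : Known ρ₅ p := (MsgOk.known (by simpa using hp) known_os).mono hρ₅
  have hs : Known ρ₅ s := MsgOk.known (by simpa using hs) known_os
  have hreq : Known ρ₅ (tup ![K .drt_req, i, p, s]) :=
    Known.tup_iff.mpr (by simpa [Fin.forall_fin_succ, hi, hp, hs] using Known.const rfl id)
  simpa using MsgOk.os hreq

theorem contract_set_pp_init (x₁ x₂ x₃ y₁ y₂ y₃ a : Term) :
    (set_pp (state x₁ x₂ x₃ (drt (prog y₁) y₂ y₃)) y₁ a).contract =
      state x₁ x₂ x₃ (drt (prog y₁) a y₃) :=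
  Edrt.contract_eq (.inr (.inr (.set_pp_init ..)))

theorem known_init_state {s : Platform} (hs : ∀ T ∈ s.components, Known ρ T) (hp : Known ρ p) :
    Known ρ { s.launched (prog Tinit) with
      pcr := h (tup ![launchPcr (prog Tinit) s.stm, h p]), pp := p }.term := by
  refine .state ?_ ⟨by simp, by simp, by simp [hchain]⟩
  simp only [Platform.components, List.forall_mem_cons] at hs ⊢
  simp [hs, hp, Known.hash, Known.entry, known_tt]

theorem safe_INIT : Safe INIT ρ v := by
  refine ⟨by simpa using MsgOk.os (.entry 0), by simpa using MsgOk.os (.entry 2), ?_⟩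
  intro ρ₁ _ v₁ _ hmsg
  have hlaunch : MsgOk ρ₁ Tinit (tup ![v₁ .nonce, v₁ .pfSt, v₁ .tpmc, v₁ .pp]) := by
    simpa using hmsg
  obtain ⟨s, hs, hpfSt, htpmc, hp⟩ := (hlaunch.privMsg (Known.not_entry 0)).inv_launch
  refine fun _ ρ₂ hρ₂ n hn => ⟨.init (s.launched (prog Tinit)) (h (v₁ .pp)), nofun, ?_⟩
  refine safe_init_exchange (by simpa using htpmc) (by simp) (by simpa using hpfSt) (by simp)
    (Function.update_self ..) (by simp) fun ρ₃ hρ₃ _ => ?_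
  have hext : ρ₁.Ext ρ₃ := hρ₂.trans ((Roles.ext_update hn _).trans hρ₃)
  have hnew := known_init_state (fun T hT => (hs T hT).mono hext) (hp.mono hext)
  refine ⟨.inr ?_, ?_, trivial⟩
  · simpa [contract_set_pp_init] using PrivMsg.drt_resp _ _ hnew
  · simpa [contract_set_pp_init] using MsgOk.os hnew

theorem Known.set_int_Tpp (hs : Known ρ s) (hW : Edrt (set_int s Tpp tt) W) : Known ρ W := by
  obtain ⟨x₁, y, z, x₂, z₁, rfl, rfl⟩ := hW.inv_set_int_Tpp
  obtain ⟨s, hs', hcomp, hok⟩ := hs.of_state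
  have hnew : Known ρ { s with int := tt }.term :=
    .state (by simp_all) ⟨hok.ne_pd, hok.ne_launch, hok.of_hchain⟩
  simp_all

theorem Known.set_lock_Tpp (hs : Known ρ (DRT.state (tpm (h (tup ![y, bot]))) b c d))
    (hW : Edrt (set_lock (DRT.state (tpm (h (tup ![y, bot]))) b c d) Tpp ff) W) :
    Known ρ W := by
  obtain ⟨x₁, x₂, x₃, y₁, y₂, y₃, hstate, rfl⟩ := hW.inv_set_lock_Tpp
  obtain ⟨s, hs', hcomp, hok⟩ := hs.of_state
  obtain ⟨hpcr, rfl, rfl, rfl⟩ : s.pcr = h (tup ![y, bot]) ∧ _ := by simpa [eq_comm] using hs'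
  obtain ⟨rfl, rfl, rfl, rfl, rfl, rfl⟩ : tpm _ = x₁ ∧ _ ∧ _ ∧ _ ∧ _ ∧ s.lock = y₃ := by
    simpa using hstate
  rw [← hpcr]
  refine .state (s := { s with lock := ff }) ?_ (hok.of_pcr_ne rfl (by simp [hpcr, hchain]))
  simp only [Platform.components, List.forall_mem_cons] at hcomp ⊢
  simp [hcomp, known_ff]

theorem safe_PP : Safe PP ρ v := by
  refine ⟨by simpa using MsgOk.os (.entry 1), fun ρ₁ _ v₁ _ hmsg hN => ?_⟩
  have hrun : MsgOk ρ₁ Tpp (tup ![v₁ .pfState0, v₁ .tpmc]) := by simpa using hmsg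
  obtain ⟨htpmc, hstate⟩ := (hrun.privMsg (Known.not_entry 1)).inv_run
  have hset : Edrt (set_int (v₁ .pfState0) Tpp tt) _ := edrt_contract (by simpa using hN)
  have hs := hstate.set_int_Tpp hset
  refine ⟨by simpa using MsgOk.os hs, safe_inp_bind fun ρ₂ hρ₂ a _ =>
    safe_inp_bind fun ρ₃ hρ₃ b hb => ⟨.inr (by simpa [htpmc] using .unsealing a),
    safe_inp_tag fun ρ₄ hρ₄ k _ hN => ⟨?_, fun ρ₅ hρ₅ n hn => ⟨.pub, nofun, ?_, ?_⟩⟩⟩⟩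
  · have hb : Known ρ₄ b := (MsgOk.known (by simpa using hb) known_os).mono hρ₄
    have hsdec : Edrt (sdec b k) _ := edrt_contract (by simpa using hN)
    simpa using MsgOk.os (hsdec.inv_sdec ▸ hb).of_senc
  · have hext : ρ₁.Ext (Function.update ρ₅ n .pub) :=
      hρ₂.trans (hρ₃.trans (hρ₄.trans (hρ₅.trans (Roles.ext_update hn _))))
    exact .inr (by simpa [htpmc] using .pp_req (.name n) (hs.mono hext))
  refine safe_inp_response (by simp) fun ρ₆ _ T hmsg hN => ⟨?_, trivial⟩
  have hresp : MsgOk ρ₆ (tpm_ch (prog Tpp)) (tup ![K .extend_resp, .name n, T]) := by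
    simpa [htpmc] using hmsg
  obtain ⟨hT, y, b, c, d, rfl⟩ := (hresp.privMsg (Known.not_tpm_ch_entry 1)).inv_pp_resp
  have hlock : Edrt (set_lock (state (tpm (h (tup ![y, bot]))) b c d) Tpp ff) _ :=
    edrt_contract (by simpa using hN)
  simpa using MsgOk.os (hT.set_lock_Tpp hlock)

end Execution

section CPU

variable {ρ : Roles} {v : Subst} {p s a b c d e i : Term}

theorem contract_set_int_cpu (x₁ y z x₂ x₃ a : Term) :
    (set_int (state x₁ (cpu y z) x₂ x₃) cpu_acc a).contract = state x₁ (cpu a z) x₂ x₃ :=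
  Edrt.contract_eq (.inr (.inr (.set_int_cpu ..)))

theorem contract_set_init_cpu (x₁ x₂ x₃ y₁ y₂ y₃ a : Term) :
    (set_init (state x₁ x₂ x₃ (drt y₁ y₂ y₃)) cpu_acc a).contract =
      state x₁ x₂ x₃ (drt a y₂ y₃) :=
  Edrt.contract_eq (.inr (.inr (.set_init ..)))

theorem contract_set_lock_cpu (x₁ x₂ x₃ y₁ y₂ y₃ a : Term) :
    (set_lock (state x₁ x₂ x₃ (drt y₁ y₂ y₃)) cpu_acc a).contract =
      state x₁ x₂ x₃ (drt y₁ y₂ a) :=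
  Edrt.contract_eq (.inr (.inr (.set_lock_cpu ..)))

theorem contract_stm (x₁ x₂ x₃ y z : Term) : (stm (state x₁ x₂ (smram y z) x₃)).contract = y :=
  Edrt.contract_eq (.inr (.inr (.stm ..)))

theorem Known.of_lock_eq_ff (hs : Known ρ s) (hlock : (lock s).contract = ff) :
    ∃ t : Platform, s = t.term ∧ ∀ T ∈ t.components, Known ρ T := by
  obtain ⟨x₁, x₂, x₃, y₁, y₂, rfl⟩ := (edrt_of_contract_eq hlock (by simp)).inv_lock
  obtain ⟨t, ht, hcomp, -⟩ := hs.of_state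
  exact ⟨t, ht, hcomp⟩

theorem MsgOk.launch {s : Platform} (hi : Known ρ (prog e)) (hs : ∀ T ∈ s.components, Known ρ T)
    (ha : Known ρ a) (hp : Known ρ p) :
    MsgOk ρ e (tup ![a, (s.launched (prog e)).term, tpm_ch (prog e), p]) := by
  rcases hi.of_prog with he | ⟨j, rfl⟩
  · have hne : e ≠ Tinit := fun heq => Known.not_entry 0 (heq ▸ he)
    have hstate : Known ρ (s.launched (prog e)).term := by
      refine .state ?_ ⟨by simp, by simp [hne], by simp [hchain]⟩
      simp only [Platform.launched, Platform.components, List.forall_mem_cons] at hs ⊢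
      simp [hs, hi, Known.hash, known_tt]
    refine .inl ⟨he, Known.tup_iff.mpr ?_⟩
    simpa [Fin.forall_fin_succ, ha, hp, -Platform.term, -Platform.launched, hstate] using he.tpm_ch
  · obtain rfl | hj := eq_or_ne j 0
    exacts [.inr (.launch a hs hp), .inr (.launch_other hj ..)]

theorem MsgOk.run (he : Known ρ (prog e)) (hs : Known ρ s) :
    MsgOk ρ e (tup ![s, tpm_ch (prog e)]) := by
  rcases he.of_prog with he | ⟨j, rfl⟩
  · exact .inl ⟨he, Known.tup_iff.mpr (by simpa [Fin.forall_fin_succ, hs] using he.tpm_ch)⟩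
  · obtain rfl | hj := eq_or_ne j 1
    exacts [.inr (.run hs), .inr (.run_other hj ..)]

/-- The part of `CPU` that starts the protected program. -/
def CPU_run : Proc :=
  .inp (V .einit) (.tup ![.test (K .drt_resp), .test (V .nonce), .bind .newState]) <|
  .letIn .epp (get_entry (pp (V .newState))) <|
  .out (V .epp) (tup ![V .newState, tpm_ch (prog (V .epp))]) <|
  .out cpu_tpm (tup ![K .ext_channel, tpm_ch (prog (V .epp))]) .nil

/-- The part of `CPU` that starts the measured program. -/
def CPU_start : Proc :=
  .letIn .s3 (set_init (V .s2) cpu_acc (V .init)) <|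
  .letIn .einit (get_entry (V .init)) <|
  .out (V .einit) (tup ![V .nonce, V .s3, tpm_ch (V .init), V .pp]) <|
  .out cpu_tpm (tup ![K .ext_channel, tpm_ch (V .init)]) CPU_run

theorem safe_CPU_run (he : Known ρ (prog (v .einit))) : Safe CPU_run ρ v := by
  refine safe_inp_response (by simp) fun ρ' hρ T hmsg hN => ?_
  have hs : Known ρ' T := by
    rcases (he.mono hρ).of_prog with hknown | ⟨j, hj⟩
    · have hT := MsgOk.known hmsg (by simpa using hknown)
      simp_all [Known.tup_iff, Fin.forall_fin_succ]
    · rcases hmsg with ⟨-, hT⟩ | hT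
      · simp_all [Known.tup_iff, Fin.forall_fin_succ]
      · exact PrivMsg.inv_drt_resp (by simpa [hj] using hT)
  have hentry : Edrt (get_entry (pp T).contract) _ := edrt_contract (by simpa using hN)
  have hpp : Known ρ' (pp T).contract :=
    .contract id fun j => by fin_cases j; exact hs
  have hepp := hentry.inv_get_entry ▸ hpp
  exact ⟨by simpa using MsgOk.run hepp hs, .inr (by simpa using .ext_channel _), trivial⟩

theorem safe_CPU_start {s : Platform} (hs : ∀ T ∈ s.components, Known ρ T)
    (hs₂ : v .s2 = { s with pcr := launchPcr (v .init) s.stm, lock := tt }.term)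
    (hi : Known ρ (v .init)) (hn : Known ρ (v .nonce)) (hp : Known ρ (v .pp)) :
    Safe CPU_start ρ v := by
  intro _ hN
  have hentry : Edrt (get_entry (v .init)) _ := edrt_contract (by simpa using hN)
  have hinit := hentry.inv_get_entry
  have hlaunch := MsgOk.launch (hinit ▸ hi) hs hn hp
  rw [← hinit] at hlaunch
  refine ⟨?_, .inr (by simpa using .ext_channel _), safe_CPU_run (by simpa [← hinit] using hi)⟩
  simpa [hs₂, contract_set_init_cpu] using hlaunch

theorem safe_CPU : Safe CPU ρ v := by
  intro ρ₁ _ v₁ _ hmsg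
  have hreq : MsgOk ρ₁ os (tup ![K .drt_req, v₁ .init, v₁ .pp, v₁ .pfState]) := by
    simpa using hmsg
  obtain ⟨-, hi, hp, hs⟩ :
      _ ∧ Known ρ₁ (v₁ .init) ∧ Known ρ₁ (v₁ .pp) ∧ Known ρ₁ (v₁ .pfState) := by
    simpa [Known.tup_iff, Fin.forall_fin_succ] using hreq.known known_os
  refine ⟨fun hlock => ?_, fun _ => trivial⟩
  obtain ⟨s, hpfState, hcomp⟩ := hs.of_lock_eq_ff (by simpa using hlock)
  refine fun _ _ _ ρ₂ hρ₂ n hn => ⟨.launch { s with int := ff, lock := tt }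
    (tup ![h (v₁ .init), h s.stm]), nofun, ?_⟩
  have hrole := Function.update_self n
    (Role.launch { s with int := ff, lock := tt } (tup ![h (v₁ .init), h s.stm])) ρ₂
  refine safe_reset_exchange (by simp)
    (by simp [hpfState, contract_set_int_cpu, contract_set_lock_cpu]) hrole (by simp)
    fun ρ₃ hρ₃ => ?_
  have hrole₃ := hρ₃.apply_eq hrole nofun
  refine safe_extend_exchange (by simp) (by simp) (by simp [hpfState, contract_stm]) hrole₃
    (by simp) fun ρ₄ hρ₄ => ?_
  have hrole₄ := hρ₄.apply_eq hrole₃ nofun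
  have hext : ρ₁.Ext ρ₄ := hρ₂.trans ((Roles.ext_update hn _).trans (hρ₃.trans hρ₄))
  have hnonce : Known ρ₄ (.name n) := .name (by simp [hrole₄]) (by simp [hrole₄])
  refine safe_CPU_start (s := { s with int := ff }) ?_ (by simp) (by simpa using hi.mono hext)
    (by simpa using hnonce) (by simpa using hp.mono hext)
  have hcomp₄ T hT := (hcomp T hT).mono hext
  simp only [Platform.components, List.forall_mem_cons] at hcomp₄ ⊢
  simp [hcomp₄, known_ff]

end CPU

/-! ### The security properties -/

theorem safe_DRTproc {ρ : Roles} {v : Subst} : Safe DRTproc ρ v :=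
  ⟨safe_TPM, safe_CPU, safe_INIT, safe_SETUP, safe_DATA, safe_PP⟩

theorem exists_initConfig_ok {Q : Proc} (hQ : Q.IsPublic) :
    ∃ ρ, (initConfig DRTproc Q).Ok ρ := by
  classical
  refine ⟨fun n => if n ∈ DRTproc.names ∪ Q.names then .pub else .free,
    fun n hn => if_neg hn, nofun, fun p hp => ?_⟩
  obtain rfl := Multiset.mem_singleton.1 hp
  refine ⟨safe_DRTproc, hQ.safe (fun x => .var x) fun n hn => ?_⟩
  refine .name ?_ ?_ <;> simp [hn]

theorem codeIntegrity : CodeIntegrity Edrt DRTproc := by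
  rintro σ ⟨Q, hQ, C, hC, hT⟩
  obtain ⟨ρ, hρ⟩ := exists_initConfig_ok hQ
  obtain ⟨ρ', -, hρ'⟩ := hρ.steps hC
  have hstate := hT.known_nf hρ'.known
  rw [nf_subst] at hstate
  obtain ⟨s, hs, -, hok⟩ := Known.of_state (by simpa using hstate)
  obtain ⟨hpcr, ⟨-, -⟩, ⟨hstm, -⟩, hinit, hpp, -⟩ : hchain = s.pcr ∧ _ := by simpa using hs
  obtain ⟨hstm', hinit', hpp', -⟩ := hok.of_hchain hpcr.symm
  rw [eqE_iff, nf_subst, nf_subst]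
  simp_all

theorem keySecrecy : KeySecrecy Edrt DRTproc := by
  rintro ⟨Q, hQ, N, M, Ps, σ, n, C, hC₁, hn, hC₂, hT⟩
  obtain ⟨ρ, hρ⟩ := exists_initConfig_ok hQ
  obtain ⟨ρ₁, -, hρ₁⟩ := hρ.steps hC₁
  obtain ⟨ρ₂, hkey, -, hρ₂⟩ := hρ₁.new hn
  obtain ⟨ρ₃, hext, hρ₃⟩ := hρ₂.steps hC₂
  exact (hT.known_nf hρ₃.known).not_key (hext.apply_eq (hkey rfl rfl) nofun)

end DRT

theorem mainTheorem1 :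
    DRT.CodeIntegrity DRT.Edrt DRT.DRTproc ∧ DRT.KeySecrecy DRT.Edrt DRT.DRTproc :=
  ⟨DRT.codeIntegrity, DRT.keySecrecy⟩
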